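/- **Setting.** Let $\Omega=\mathrm{BUC}(\mathbb R)$ be the set of bounded uniformly continuous functions $V:\mathbb R\to\mathbb R$, with the $\sigma$-algebra $\mathcal F$ generated by the evaluations $V\mapsto V(x)$, and translations $(T_yV)(x)=V(x+y)$. Let $\mathbb P$ be a probability measure on $(\Omega,\mathcal F)$ and $\overline m>0$ such that $\operatorname{ess\,sup}_{\mathbb R} V=0$ and $\operatorname{ess\,sup}_{\mathbb R}(-V)=\overline m$ $\mathbb P$-almost surely, $\mathbb P[T_yE]=\mathbb P[E]$ and $\mathbb P[\bigcap_{z\in\mathbb R}T_zE]\in\{0,1\}$ for all $E\in\mathcal F$, $y\in\mathbb R$. For $G\in C(\mathbb R)$ with $G(p)\to+\infty$ as $|p|\to\infty$, the pair $(G,V)$ is called *regularly homogenizable* if for every $p\in\mathbb R$ there is $\overline G(p)\in\mathbb R$ such that for every $R>0$ $$\mathbb P\Big[\limsup_{\lambda\to0^+}\max_{|y|\le R/\lambda}\big|\lambda v_\lambda(y,p)+\overline G(p)\big|=0\Big]=1,$$ where, for $\lambda>0$, $v_\lambda(\cdot,p)$ is the unique bounded continuous viscosity solution of $\lambda v_\lambda+G(p+v_\lambda')+V(y)=0$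 in $\mathbb R$. The function $\overline G$ is the effective Hamiltonian. **The Hamiltonian.** Let $H:\mathbb R\to[0,\infty)$ be Lipschitz continuous with $H(0)=0$ and $H(p)\to+\infty$ as $|p|\to\infty$. Suppose that $H$ is strictly decreasing on $(-\infty,0]$ and that there are $L\ge 0$ and $p_1>p_2>\dots>p_{2L}>p_{2L+1}=0$ such that $H$ is strictly increasing on $[p_1,\infty)$ and on $[p_{2i+1},p_{2i}]$, strictly decreasing on $[p_{2i},p_{2i-1}]$ ($1\le i\le L$), and $H(p_1),\dots,H(p_{2L})$ are distinct positive numbers. Put $m_i=H(p_{2i-1})$ and $M_i=H(p_{2i})$ for $1\le i\le L$. Assume that $L\ge1$ and $$\overline m<\max_{1\le i,j\le L}(M_i-m_j),$$ and let $k,l\in\{1,\dots,L\}$ be the indices with $M_k=\max_iM_i$ and $m_l=\min_im_i$. Assume $l>k$. **The auxiliary Hamiltonians.** Let $H_1:\mathbb R\to[0,\infty)$ be coercive and Lipschitz with $H_1\ge H$, $H_1=H$ on $(-\infty,p_{2k}]$ and $H_1$ strictly increasing on $(p_{2k},\infty)$. Let $H_2:\mathbb R\to[m_l,\infty)$ be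 coercive and Lipschitz with $H_2\ge H$, $H_2=H$ on $[p_{2l},\infty)$ and $H_2$ strictly decreasing on $(-\infty,p_{2l})$. Let $H_3=\max\{H_1,H_2\}$. **Lemma.** If $(H_1,V)$, $(H_2,V)$ and $(H_3,V)$ are regularly homogenizable, then so is $(H,V)$, and $\overline H=\min\{\overline H_1,\overline H_2\}$ on $\mathbb R$. -/

import Mathlib

open Set Filter Topology MeasureTheory

/-! ## The probability space of potentials -/

/-- The space of bounded, uniformly continuous real functions on `ℝ`. -/
def BUC : Type :=
  {V : ℝ → ℝ // UniformContinuous V ∧ ∃ C : ℝ, ∀ x, |V x| ≤ C}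

instance : CoeFun BUC (fun _ => ℝ → ℝ) := ⟨fun V => V.1⟩

/-- The `σ`-algebra on `BUC` generated by the evaluations `V ↦ V x`. -/
instance : MeasurableSpace BUC :=
  ⨆ x : ℝ, MeasurableSpace.comap (fun V : BUC => V x) (borel ℝ)

/-- The translation `(T_y V)(x) = V (x + y)`. -/
def BUC.shift (y : ℝ) (V : BUC) : BUC :=
  ⟨fun x => V (x + y),
    V.2.1.comp (uniformContinuous_id.add uniformContinuous_const),
    V.2.2.imp fun _ hC x => hC (x + y)⟩

/-- The law `P` of the random potential is normalized (almost surely `ess sup V = 0` and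
`ess sup (-V) = mbar`, where `mbar > 0`), stationary and ergodic. -/
structure IsPotentialLaw (P : Measure BUC) (mbar : ℝ) : Prop where
  mbar_pos : 0 < mbar
  esssup_eq : ∀ᵐ V ∂P, essSup (fun x : ℝ => V x) volume = 0
  esssup_neg_eq : ∀ᵐ V ∂P, essSup (fun x : ℝ => -V x) volume = mbar
  stationary : ∀ E : Set BUC, MeasurableSet E → ∀ y : ℝ, P E = P (BUC.shift y '' E)
  ergodic : ∀ E : Set BUC, MeasurableSet E →
    P (⋂ z : ℝ, BUC.shift z '' E) = 0 ∨ P (⋂ z : ℝ, BUC.shift z '' E) = 1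

/-- `H p → +∞` as `|p| → ∞`. -/
def CoerciveAtInfinity (H : ℝ → ℝ) : Prop := Tendsto H (cocompact ℝ) atTop

/-! ## Viscosity solutions on the real line -/

/-- `v` is a viscosity subsolution of `F(y, v, v') = 0` in `ℝ`. -/
def IsViscositySubsolution (F : ℝ → ℝ → ℝ → ℝ) (v : ℝ → ℝ) : Prop :=
  ∀ φ : ℝ → ℝ, ContDiff ℝ 1 φ → ∀ y : ℝ,
    IsLocalMax (fun x => v x - φ x) y → F y (v y) (deriv φ y) ≤ 0

/-- `v` is a viscosity supersolution of `F(y, v, v') = 0` in `ℝ`. -/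
def IsViscositySupersolution (F : ℝ → ℝ → ℝ → ℝ) (v : ℝ → ℝ) : Prop :=
  ∀ φ : ℝ → ℝ, ContDiff ℝ 1 φ → ∀ y : ℝ,
    IsLocalMin (fun x => v x - φ x) y → 0 ≤ F y (v y) (deriv φ y)

/-- `v` is a bounded continuous viscosity solution of
`lam * v + H (p + v') + V y = 0` in `ℝ`. -/
structure IsCellSolution (H : ℝ → ℝ) (V : BUC) (p lam : ℝ) (v : ℝ → ℝ) : Prop where
  continuous : Continuous v
  bounded : ∃ C : ℝ, ∀ y, |v y| ≤ C
  sub : IsViscositySubsolution (fun y r q => lam * r + H (p + q) + V y) v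
  super : IsViscositySupersolution (fun y r q => lam * r + H (p + q) + V y) v

/-! ## Regular homogenizability and the effective Hamiltonian -/

/-- The number `c` is the effective Hamiltonian at `p`: for every `R > 0`, almost surely,
`max_{|y| ≤ R / lam} |lam * v_lam(y) + c| → 0` as `lam → 0⁺`, where `v_lam` is the unique bounded
continuous viscosity solution of the cell problem with parameter `lam > 0`. -/
def HasEffectiveValue (P : Measure BUC) (H : ℝ → ℝ) (p c : ℝ) : Prop :=
  ∀ R : ℝ, 0 < R → ∀ᵐ V ∂P, ∃ v : ℝ → ℝ → ℝ,
    (∀ lam : ℝ, 0 < lam → IsCellSolution H V p lam (v lam) ∧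
      ∀ w : ℝ → ℝ, IsCellSolution H V p lam w → w = v lam) ∧
    ∀ ε : ℝ, 0 < ε → ∀ᶠ lam in 𝓝[>] (0 : ℝ),
      ∀ y : ℝ, |y| ≤ R / lam → |lam * v lam y + c| ≤ ε

/-- The pair of the Hamiltonian `H` and the random potential with law `P` is regularly
homogenizable at `p`. -/
structure RegularlyHomogenizableAt (P : Measure BUC) (H : ℝ → ℝ) (p : ℝ) : Prop where
  law : ∃ mbar : ℝ, IsPotentialLaw P mbar
  continuous : Continuous H
  coercive : CoerciveAtInfinity H
  exists_value : ∃ c : ℝ, HasEffectiveValue P H p c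

/-- Regular homogenizability at every `p`. -/
def RegularlyHomogenizable (P : Measure BUC) (H : ℝ → ℝ) : Prop :=
  ∀ p : ℝ, RegularlyHomogenizableAt P H p

/-- The effective value at `p` is unique, so that the effective Hamiltonian is well defined. -/
theorem HasEffectiveValue.unique {P : Measure BUC} [IsProbabilityMeasure P] {H : ℝ → ℝ}
    {p c d : ℝ} (hc : HasEffectiveValue P H p c) (hd : HasEffectiveValue P H p d) : c = d := by
  obtain ⟨V, ⟨v, hv, hvc⟩, ⟨w, hw, hwd⟩⟩ := ((hc 1 one_pos).and (hd 1 one_pos)).exists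
  by_contra hne
  have hpos : 0 < |c - d| / 3 := by
    have := abs_pos.mpr (sub_ne_zero.mpr hne)
    positivity
  obtain ⟨lam, ⟨h1, h2⟩, hlam⟩ :=
    (((hvc _ hpos).and (hwd _ hpos)).and self_mem_nhdsWithin).exists
  have hl : (0 : ℝ) < lam := hlam
  have e : w lam = v lam := (hv lam hl).2 _ (hw lam hl).1
  have h0 : |(0 : ℝ)| ≤ 1 / lam := by rw [abs_zero]; positivity
  have k1 := h1 0 h0
  have k2 := h2 0 h0
  rw [e] at k2
  have k3 : |c - d| ≤ |lam * v lam 0 + c| + |lam * v lam 0 + d| := by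
    have := abs_sub (lam * v lam 0 + c) (lam * v lam 0 + d)
    rwa [add_sub_add_left_eq_sub] at this
  linarith

/-- The effective Hamiltonian `p ↦ H̄(p)` of a regularly homogenizable pair. -/
noncomputable def effectiveHamiltonian {P : Measure BUC} {H : ℝ → ℝ}
    (h : RegularlyHomogenizable P H) (p : ℝ) : ℝ :=
  (h p).exists_value.choose

theorem effectiveHamiltonian_spec {P : Measure BUC} {H : ℝ → ℝ}
    (h : RegularlyHomogenizable P H) (p : ℝ) :
    HasEffectiveValue P H p (effectiveHamiltonian h p) :=
  (h p).exists_value.choose_spec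

/-! ## The Hamiltonians -/

/-- `H` is Lipschitz, coercive and nonnegative with `min H = H 0 = 0`, it is strictly decreasing on
`(-∞, 0]`, and on `[0, ∞)` it is piecewise strictly monotone with `L` wells: its turning points are
`pt 1 > pt 2 > ⋯ > pt (2L) > pt (2L+1) = 0`; the odd ones are local minima and the even ones local
maxima, and the values at `pt 1, …, pt (2L)` are distinct and positive. (Only the values of `pt` at
the indices `1, …, 2L+1` matter.) -/
structure IsOscillatingHamiltonian (H : ℝ → ℝ) (L : ℕ) (pt : ℕ → ℝ) : Prop where
  lipschitz : ∃ K, LipschitzWith K H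
  nonneg : ∀ q, 0 ≤ H q
  zero : H 0 = 0
  coercive : CoerciveAtInfinity H
  pt_last : pt (2 * L + 1) = 0
  pt_lt : ∀ i, 1 ≤ i → i ≤ 2 * L → pt (i + 1) < pt i
  incr_last : StrictMonoOn H (Ici (pt 1))
  incr : ∀ i, 1 ≤ i → i ≤ L → StrictMonoOn H (Icc (pt (2 * i + 1)) (pt (2 * i)))
  decr : ∀ i, 1 ≤ i → i ≤ L → StrictAntiOn H (Icc (pt (2 * i)) (pt (2 * i - 1)))
  values_pos : ∀ i, 1 ≤ i → i ≤ 2 * L → 0 < H (pt i)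
  values_inj : InjOn (fun i => H (pt i)) (Icc 1 (2 * L))
  decr_left : StrictAntiOn H (Iic 0)

/-- `H₁ ≥ H` is Lipschitz and coercive with values in `[0, ∞)`, agrees with `H` on `(-∞, a]` and is
strictly increasing on `(a, ∞)`. -/
structure IsRightFlattening (H : ℝ → ℝ) (a : ℝ) (H₁ : ℝ → ℝ) : Prop where
  lipschitz : ∃ K, LipschitzWith K H₁
  coercive : CoerciveAtInfinity H₁
  nonneg : ∀ q, 0 ≤ H₁ q
  ge : ∀ q, H q ≤ H₁ q
  eqOn : EqOn H₁ H (Iic a)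
  incr : StrictMonoOn H₁ (Ioi a)

/-- `H₂ ≥ H` is Lipschitz and coercive with values in `[m, ∞)`, agrees with `H` on `[b, ∞)` and is
strictly decreasing on `(-∞, b)`. -/
structure IsLeftFlattening (H : ℝ → ℝ) (m b : ℝ) (H₂ : ℝ → ℝ) : Prop where
  lipschitz : ∃ K, LipschitzWith K H₂
  coercive : CoerciveAtInfinity H₂
  lower : ∀ q, m ≤ H₂ q
  ge : ∀ q, H q ≤ H₂ q
  eqOn : EqOn H₂ H (Ici b)
  decr : StrictAntiOn H₂ (Iio b)

/-! Put `a = pt (2k)` and `b = pt (2l-1)`. Since `k < l`, `b < a`, and the oscillation hypothesis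
gives `mbar < H a - H b`. Almost surely `-mbar ≤ V ≤ 0` everywhere, and the argument then works with
one such potential.

Let `v` solve the cell problem for a Hamiltonian `G` with effective value `c`. On balls of radius `R
/ lam` the quantity `G (p + v') = -lam v - V` lies, up to a small error, in `[c, c + mbar]`. A slope
`q` with `G q < c` or `G q > c + mbar` therefore cannot be crossed: `v - (q - p) x` has no local
minimum, respectively maximum. As `lam v` is nearly constant on such balls, the mean of `p + v'` is
nearly `p`, so `p + v'` stays on the side of `q` that contains `p`. If `G = H` on that side, `v`
also solves the problem for `H` there, and local comparison gives `H` the value `c`.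

This is applied to `H₁` and `H₂` with barriers `a` and `b`, for `p ≠ a, b`. If `c₁ + mbar < H a`,
then `a` is a barrier for `H₁`. Otherwise `c₁ > H b`, so `b` is a barrier for `H₁` when `p < b`; for
`p > b`, either `c₂ > H b` and `b` is a barrier for `H₂`, or `c₂ + mbar < H a` and `a` is. In this
last case with `b < p < a` the slopes lie where `H₃ = max H H₂ = H₂`, hence `c₃ ≤ c₂ ≤ H b < c₁ ≤
c₃`, which is absurd. This is `hasValueAt_min`. The values `p = a, b` follow by Lipschitz dependence
on `p`. Existence of cell solutions for `H` comes from a monotone difference scheme. -/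

/-- `u` is a viscosity subsolution of `lam * u + F (u') + V = 0` at the points of `I`. -/
def SubsolutionOn (F V : ℝ → ℝ) (lam : ℝ) (u : ℝ → ℝ) (I : Set ℝ) : Prop :=
  ∀ φ : ℝ → ℝ, ContDiff ℝ 1 φ → ∀ y ∈ I,
    IsLocalMax (fun x => u x - φ x) y → lam * u y + F (deriv φ y) + V y ≤ 0

/-- `w` is a viscosity supersolution of `lam * w + F (w') + V = 0` at the points of `I`. -/
def SupersolutionOn (F V : ℝ → ℝ) (lam : ℝ) (w : ℝ → ℝ) (I : Set ℝ) : Prop :=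
  ∀ φ : ℝ → ℝ, ContDiff ℝ 1 φ → ∀ y ∈ I,
    IsLocalMin (fun x => w x - φ x) y → 0 ≤ lam * w y + F (deriv φ y) + V y

/-! ### Dependence on the domain and on the Hamiltonian -/

section Basic

variable {F G V : ℝ → ℝ} {lam : ℝ} {v : ℝ → ℝ} {I J : Set ℝ}

theorem SubsolutionOn.mono (h : SubsolutionOn F V lam v I) (hJ : J ⊆ I) :
    SubsolutionOn F V lam v J :=
  fun φ hφ y hy => h φ hφ y (hJ hy)

theorem SupersolutionOn.mono (h : SupersolutionOn F V lam v I) (hJ : J ⊆ I) :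
    SupersolutionOn F V lam v J :=
  fun φ hφ y hy => h φ hφ y (hJ hy)

theorem SubsolutionOn.of_le (h : SubsolutionOn F V lam v I) (hFG : ∀ q, G q ≤ F q) :
    SubsolutionOn G V lam v I := by
  intro φ hφ y hy hm
  linarith [h φ hφ y hy hm, hFG (deriv φ y)]

theorem SupersolutionOn.of_le (h : SupersolutionOn F V lam v I) (hFG : ∀ q, F q ≤ G q) :
    SupersolutionOn G V lam v I := by
  intro φ hφ y hy hm
  linarith [h φ hφ y hy hm, hFG (deriv φ y)]

theorem IsCellSolution.subsolutionOn {H : ℝ → ℝ} {V : BUC} {p : ℝ}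
    (h : IsCellSolution H V p lam v) (I : Set ℝ) :
    SubsolutionOn (fun q => H (p + q)) V lam v I :=
  fun φ hφ y _ hm => h.sub φ hφ y hm

theorem IsCellSolution.supersolutionOn {H : ℝ → ℝ} {V : BUC} {p : ℝ}
    (h : IsCellSolution H V p lam v) (I : Set ℝ) :
    SupersolutionOn (fun q => H (p + q)) V lam v I :=
  fun φ hφ y _ hm => h.super φ hφ y hm

end Basic

/-! ### Comparison principles -/

theorem exists_tendsto_hyperfilter {x : ℕ → ℝ} {a b : ℝ} (hx : ∀ n, x n ∈ Icc a b) :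
    ∃ l ∈ Icc a b, Tendsto x (hyperfilter ℕ : Filter ℕ) (𝓝 l) := by
  obtain ⟨l, hl, h⟩ := (isCompact_Icc (a := a) (b := b)).ultrafilter_le_nhds
    ((hyperfilter ℕ).map x)
    (le_principal_iff.2 (Filter.mem_map.2 (univ_mem' hx)))
  exact ⟨l, hl, h⟩

/-- Comparison on a bounded interval, with an error that is small for long intervals. -/
theorem comparison_Icc {F G V u w : ℝ → ℝ} {K lam η B r : ℝ} (hlam : 0 < lam) (hr : 0 < r)
    (hK0 : 0 ≤ K) (hη : 0 ≤ η) (hB0 : 0 ≤ B)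
    (hK : ∀ a b, |F a - F b| ≤ K * |a - b|) (hFG : ∀ q, G q ≤ F q + η)
    (hV : Continuous V) (hu : Continuous u) (hw : Continuous w)
    (hsub : SubsolutionOn F V lam u (Ioo (-r) r))
    (hsup : SupersolutionOn G V lam w (Ioo (-r) r))
    (hB : ∀ x ∈ Icc (-r) r, u x - w x ≤ B) {y₀ : ℝ} (hy₀ : y₀ ∈ Icc (-r) r) :
    lam * (u y₀ - w y₀) ≤ η + 2 * K * B / r + lam * (B / r ^ 2 * y₀ ^ 2) := by
  by_contra! hcon
  -- With `β * r ^ 2 = B` the penalty cancels `u - w` at the endpoints, so the doubled maximum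
  -- cannot concentrate there.
  set β : ℝ := B / r ^ 2 with hβ
  have hβ0 : 0 ≤ β := by positivity
  have hβr : β * r ^ 2 = B := by rw [hβ]; field_simp
  set s : ℝ := u y₀ - w y₀ - β * y₀ ^ 2 with hs
  have hls : η + 2 * K * B / r < lam * s := by rw [hs]; linarith
  have hs0 : 0 < s := by
    have : 0 ≤ η + 2 * K * B / r := by positivity
    exact pos_of_mul_pos_right (this.trans_lt hls) hlam.le
  have hQ : IsCompact (Icc (-r) r ×ˢ Icc (-r) r) := isCompact_Icc.prod isCompact_Icc
  have hQne : (Icc (-r) r ×ˢ Icc (-r) r).Nonempty := ⟨(y₀, y₀), hy₀, hy₀⟩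
  have hex : ∀ n : ℕ, ∃ z ∈ Icc (-r) r ×ˢ Icc (-r) r,
      IsMaxOn (fun z : ℝ × ℝ => u z.1 - w z.2 - n * (z.1 - z.2) ^ 2 - β * z.1 ^ 2)
        (Icc (-r) r ×ˢ Icc (-r) r) z := fun n =>
    hQ.exists_isMaxOn hQne (by fun_prop)
  choose z hz hmax using hex
  obtain ⟨zD, _, hD⟩ := hQ.exists_isMaxOn hQne
    (f := fun z : ℝ × ℝ => u z.1 - w z.2) (by fun_prop)
  set D := u zD.1 - w zD.2
  have hDb : ∀ n, u (z n).1 - w (z n).2 ≤ D := fun n => hD (hz n)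
  have hge : ∀ n : ℕ, s ≤ u (z n).1 - w (z n).2 - n * ((z n).1 - (z n).2) ^ 2
      - β * (z n).1 ^ 2 := by
    intro n
    have := hmax n (show (y₀, y₀) ∈ Icc (-r) r ×ˢ Icc (-r) r from ⟨hy₀, hy₀⟩)
    simp only [mem_ofPred_eq, sub_self] at this
    rw [hs]; linarith
  -- Limits along an ultrafilter replace successive extraction of subsequences.
  obtain ⟨x', hx', hxt⟩ := exists_tendsto_hyperfilter (x := fun n => (z n).1) (fun n => (hz n).1)
  obtain ⟨y', hy', hyt⟩ := exists_tendsto_hyperfilter (x := fun n => (z n).2) (fun n => (hz n).2)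
  have hxy : x' = y' := by
    have h1 : Tendsto (fun n => ((z n).1 - (z n).2) ^ 2) (hyperfilter ℕ : Filter ℕ)
        (𝓝 ((x' - y') ^ 2)) := (hxt.sub hyt).pow 2
    have h2 : Tendsto (fun n : ℕ => D / n) (hyperfilter ℕ : Filter ℕ) (𝓝 0) :=
      (tendsto_const_div_atTop_nhds_zero_nat D).mono_left Nat.hyperfilter_le_atTop
    have h3 : (x' - y') ^ 2 ≤ 0 := by
      refine le_of_tendsto_of_tendsto h1 h2 ?_
      have : ∀ᶠ n : ℕ in (hyperfilter ℕ : Filter ℕ), 0 < n :=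
        Nat.hyperfilter_le_atTop (eventually_gt_atTop 0)
      filter_upwards [this] with n hn
      have hn' : (0 : ℝ) < n := by exact_mod_cast hn
      rw [le_div_iff₀ hn']
      nlinarith [hge n, hDb n, mul_nonneg hβ0 (sq_nonneg (z n).1)]
    nlinarith [sq_nonneg (x' - y')]
  subst hxy
  have hut : Tendsto (fun n => u (z n).1) (hyperfilter ℕ : Filter ℕ) (𝓝 (u x')) :=
    (hu.tendsto x').comp hxt
  have hwt : Tendsto (fun n => w (z n).2) (hyperfilter ℕ : Filter ℕ) (𝓝 (w x')) :=
    (hw.tendsto x').comp hyt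
  have hVx : Tendsto (fun n => V (z n).1) (hyperfilter ℕ : Filter ℕ) (𝓝 (V x')) :=
    (hV.tendsto x').comp hxt
  have hVy : Tendsto (fun n => V (z n).2) (hyperfilter ℕ : Filter ℕ) (𝓝 (V x')) :=
    (hV.tendsto x').comp hyt
  have hsx : s ≤ u x' - w x' - β * x' ^ 2 := by
    refine ge_of_tendsto ((hut.sub hwt).sub ((hxt.pow 2).const_mul β))
      (Eventually.of_forall fun n => ?_)
    have : (0 : ℝ) ≤ n * ((z n).1 - (z n).2) ^ 2 := by positivity
    linarith [hge n]
  have hxI : x' ∈ Ioo (-r) r := by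
    have hB' := hB x' hx'
    have hlt : x' ^ 2 < r ^ 2 := by
      by_contra! h
      nlinarith [mul_le_mul_of_nonneg_left h hβ0]
    exact abs_lt.1 (abs_lt_of_sq_lt_sq hlt hr.le)
  have hIx : ∀ᶠ n in (hyperfilter ℕ : Filter ℕ), (z n).1 ∈ Ioo (-r) r :=
    hxt (isOpen_Ioo.mem_nhds hxI)
  have hIy : ∀ᶠ n in (hyperfilter ℕ : Filter ℕ), (z n).2 ∈ Ioo (-r) r :=
    hyt (isOpen_Ioo.mem_nhds hxI)
  have hkey : lam * (u x' - w x') ≤ η + 2 * K * B / r + (V x' - V x') := by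
    refine le_of_tendsto_of_tendsto ((hut.sub hwt).const_mul lam)
      ((hVy.sub hVx).const_add _) ?_
    filter_upwards [hIx, hIy] with n h1 h2
    have d1 : deriv (fun x => n * (x - (z n).2) ^ 2 + β * x ^ 2) (z n).1
        = 2 * n * ((z n).1 - (z n).2) + 2 * β * (z n).1 := by
      have : HasDerivAt (fun x => n * (x - (z n).2) ^ 2 + β * x ^ 2)
          (n * (2 * ((z n).1 - (z n).2) ^ 1 * 1) + β * (2 * (z n).1 ^ 1 * 1)) (z n).1 := by
        simpa using ((((hasDerivAt_id (z n).1).sub_const (z n).2).pow 2).const_mul (n : ℝ)).fun_add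
          (((hasDerivAt_id (z n).1).pow 2).const_mul β)
      rw [this.deriv]; ring
    have d2 : deriv (fun y => -(n * ((z n).1 - y) ^ 2)) (z n).2
        = 2 * n * ((z n).1 - (z n).2) := by
      have : HasDerivAt (fun y => -(n * ((z n).1 - y) ^ 2))
          (-(n * (2 * ((z n).1 - (z n).2) ^ 1 * (-1)))) (z n).2 := by
        simpa using ((((hasDerivAt_id (z n).2).const_sub (z n).1).pow 2).const_mul (n : ℝ)).fun_neg
      rw [this.deriv]; ring
    have e1 := hsub (fun x => n * (x - (z n).2) ^ 2 + β * x ^ 2) (by fun_prop) (z n).1 h1 (by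
      filter_upwards [isOpen_Ioo.mem_nhds h1] with x hx
      have := hmax n (show (x, (z n).2) ∈ Icc (-r) r ×ˢ Icc (-r) r from
        ⟨Ioo_subset_Icc_self hx, (hz n).2⟩)
      simp only [mem_ofPred_eq] at this
      linarith)
    have e2 := hsup (fun y => -(n * ((z n).1 - y) ^ 2)) (by fun_prop) (z n).2 h2 (by
      filter_upwards [isOpen_Ioo.mem_nhds h2] with x hx
      have := hmax n (show ((z n).1, x) ∈ Icc (-r) r ×ˢ Icc (-r) r from
        ⟨(hz n).1, Ioo_subset_Icc_self hx⟩)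
      simp only [mem_ofPred_eq] at this
      linarith)
    rw [d1] at e1
    rw [d2] at e2
    have e3 := hFG (2 * n * ((z n).1 - (z n).2))
    have e4 := hK (2 * n * ((z n).1 - (z n).2))
      (2 * n * ((z n).1 - (z n).2) + 2 * β * (z n).1)
    -- The localization tilts one of the two gradients by `2 * β * x`, at most `2 * B / r`; the
    -- Lipschitz bound turns this into the error `2 * K * B / r`.
    have e5 : |2 * n * ((z n).1 - (z n).2) - (2 * n * ((z n).1 - (z n).2) + 2 * β * (z n).1)|
        ≤ 2 * B / r := by
      have : 2 * n * ((z n).1 - (z n).2) - (2 * n * ((z n).1 - (z n).2) + 2 * β * (z n).1)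
          = -(2 * β * (z n).1) := by ring
      rw [this, abs_neg, abs_mul, abs_of_nonneg (by positivity : 0 ≤ 2 * β),
        le_div_iff₀ hr, ← hβr]
      have := abs_le.2 (hz n).1
      nlinarith [mul_le_mul_of_nonneg_left this (by positivity : 0 ≤ 2 * β * r)]
    have e6 := mul_le_mul_of_nonneg_left e5 hK0
    have e7 := (abs_le.1 e4).2
    have e8 : K * (2 * B / r) = 2 * K * B / r := by ring
    linarith
  have hf : lam * s ≤ lam * (u x' - w x') :=
    mul_le_mul_of_nonneg_left (by nlinarith [mul_nonneg hβ0 (sq_nonneg x')]) hlam.le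
  linarith

/-- For bounded differences both error terms of `comparison_Icc` vanish as `r → ∞`. The slack `η`
allows the Hamiltonians at two different `p` to be compared. -/
theorem comparison_univ {F G V u w : ℝ → ℝ} {K lam η B : ℝ} (hlam : 0 < lam)
    (hK0 : 0 ≤ K) (hη : 0 ≤ η)
    (hK : ∀ a b, |F a - F b| ≤ K * |a - b|) (hFG : ∀ q, G q ≤ F q + η)
    (hV : Continuous V) (hu : Continuous u) (hw : Continuous w)
    (hsub : SubsolutionOn F V lam u univ) (hsup : SupersolutionOn G V lam w univ)
    (hB : ∀ x, u x - w x ≤ B) (y : ℝ) : lam * (u y - w y) ≤ η := by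
  have h1 : Tendsto (fun r : ℝ => η + 2 * K * max B 0 / r
      + lam * (max B 0 / r ^ 2 * y ^ 2)) atTop (𝓝 (η + 0 + lam * (0 * y ^ 2))) :=
    ((tendsto_id.const_div_atTop _).const_add η).add
      (((tendsto_const_nhds.div_atTop (tendsto_pow_atTop two_ne_zero)).mul_const _).const_mul _)
  have h2 : η + 0 + lam * (0 * y ^ 2) = η := by ring
  rw [h2] at h1
  refine ge_of_tendsto h1 ?_
  filter_upwards [eventually_gt_atTop |y|] with r hr
  exact comparison_Icc hlam ((abs_nonneg y).trans_lt hr) hK0 hη (le_max_right _ _) hK hFG hV hu hw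
    (hsub.mono (subset_univ _)) (hsup.mono (subset_univ _))
    (fun x _ => (hB x).trans (le_max_left _ _)) (abs_le.1 hr.le)

/-! ### One-sided slope bounds from the absence of local extrema -/

section Slopes

variable {g : ℝ → ℝ} {s t r : ℝ}

/-- If `g` dropped from `x` to `y`, its minimum over `[x, r]` would be interior: it lies below `g
x`, and the larger value at the far point `r` excludes the right end. The three variants follow by
the mirrored argument or by negation. -/
theorem monotoneOn_of_not_isLocalMin (hg : Continuous g) (htr : t < r)
    (hmin : ∀ y ∈ Ioo s r, ¬ IsLocalMin g y) (hr : ∀ y ∈ Icc s t, g y < g r) :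
    MonotoneOn g (Icc s t) := by
  intro x hx y hy hxy
  by_contra! hlt
  have hxr : x ≤ r := hx.2.trans htr.le
  obtain ⟨z, hz, hm⟩ := (isCompact_Icc (a := x) (b := r)).exists_isMinOn
    (nonempty_Icc.2 hxr) hg.continuousOn
  have h1 : g z ≤ g y := hm ⟨hxy, hy.2.trans htr.le⟩
  have hzx : z ≠ x := by rintro rfl; linarith
  have hzr : z ≠ r := by rintro rfl; linarith [hr y hy]
  have hzI : z ∈ Ioo x r := ⟨lt_of_le_of_ne hz.1 hzx.symm, lt_of_le_of_ne hz.2 hzr⟩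
  exact hmin z ⟨hx.1.trans_lt hzI.1, hzI.2⟩ (hm.isLocalMin (Icc_mem_nhds hzI.1 hzI.2))

theorem antitoneOn_of_not_isLocalMax (hg : Continuous g) (htr : t < r)
    (hmax : ∀ y ∈ Ioo s r, ¬ IsLocalMax g y) (hr : ∀ y ∈ Icc s t, g r < g y) :
    AntitoneOn g (Icc s t) := by
  have h := monotoneOn_of_not_isLocalMin (g := fun x => -g x) hg.neg htr
    (fun y hy h => hmax y hy (by simpa using h.neg)) (fun y hy => neg_lt_neg (hr y hy))
  exact fun x hx y hy hxy => neg_le_neg_iff.1 (h hx hy hxy)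

theorem antitoneOn_of_not_isLocalMin (hg : Continuous g) (hrs : r < s)
    (hmin : ∀ y ∈ Ioo r t, ¬ IsLocalMin g y) (hr : ∀ y ∈ Icc s t, g y < g r) :
    AntitoneOn g (Icc s t) := by
  intro x hx y hy hxy
  by_contra! hlt
  have hry : r ≤ y := hrs.le.trans hy.1
  obtain ⟨z, hz, hm⟩ := (isCompact_Icc (a := r) (b := y)).exists_isMinOn
    (nonempty_Icc.2 hry) hg.continuousOn
  have h1 : g z ≤ g x := hm ⟨hrs.le.trans hx.1, hxy⟩
  have hzx : z ≠ y := by rintro rfl; linarith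
  have hzr : z ≠ r := by rintro rfl; linarith [hr x hx]
  have hzI : z ∈ Ioo r y := ⟨lt_of_le_of_ne hz.1 hzr.symm, lt_of_le_of_ne hz.2 hzx⟩
  exact hmin z ⟨hzI.1, hzI.2.trans_le hy.2⟩ (hm.isLocalMin (Icc_mem_nhds hzI.1 hzI.2))

theorem monotoneOn_of_not_isLocalMax (hg : Continuous g) (hrs : r < s)
    (hmax : ∀ y ∈ Ioo r t, ¬ IsLocalMax g y) (hr : ∀ y ∈ Icc s t, g r < g y) :
    MonotoneOn g (Icc s t) := by
  have h := antitoneOn_of_not_isLocalMin (g := fun x => -g x) hg.neg hrs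
    (fun y hy h => hmax y hy (by simpa using h.neg)) (fun y hy => neg_lt_neg (hr y hy))
  exact fun x hx y hy hxy => neg_le_neg_iff.1 (h hx hy hxy)

end Slopes

/-! ### Changing the Hamiltonian outside the range of slopes -/

section Transfer

variable {F G V : ℝ → ℝ} {lam a : ℝ} {v : ℝ → ℝ} {I J : Set ℝ}

theorem le_of_hasDerivAt_of_eventually_right {φ : ℝ → ℝ} {d y : ℝ} (hd : HasDerivAt φ d y)
    (h : ∀ᶠ x in 𝓝[>] y, φ x - φ y ≤ a * (x - y)) : d ≤ a := by
  have h1 : Tendsto (slope φ y) (𝓝[>] y) (𝓝 d) :=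
    (hasDerivAt_iff_tendsto_slope.1 hd).mono_left
      (nhdsWithin_mono _ fun x (hx : y < x) => hx.ne')
  refine le_of_tendsto h1 ?_
  filter_upwards [h, self_mem_nhdsWithin] with x hx (hxy : y < x)
  rw [slope_def_field, div_le_iff₀ (sub_pos.2 hxy)]
  exact hx

theorem ge_of_hasDerivAt_of_eventually_left {φ : ℝ → ℝ} {d y : ℝ} (hd : HasDerivAt φ d y)
    (h : ∀ᶠ x in 𝓝[<] y, a * (y - x) ≤ φ y - φ x) : a ≤ d := by
  have h1 : Tendsto (slope φ y) (𝓝[<] y) (𝓝 d) :=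
    (hasDerivAt_iff_tendsto_slope.1 hd).mono_left
      (nhdsWithin_mono _ fun x (hx : x < y) => hx.ne)
  refine ge_of_tendsto h1 ?_
  filter_upwards [h, self_mem_nhdsWithin] with x hx (hxy : x < y)
  rw [slope_comm, slope_def_field, le_div_iff₀ (sub_pos.2 hxy)]
  exact hx

theorem le_of_hasDerivAt_of_eventually_left {φ : ℝ → ℝ} {d y : ℝ} (hd : HasDerivAt φ d y)
    (h : ∀ᶠ x in 𝓝[<] y, φ y - φ x ≤ a * (y - x)) : d ≤ a := by
  have := ge_of_hasDerivAt_of_eventually_left (a := -a) hd.neg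
    (h.mono fun x hx => by simp only [Pi.neg_apply]; linarith)
  linarith

/-- A supersolution whose slopes are at least `a` is a supersolution for every Hamiltonian that
agrees with the given one on `[a, ∞)`. -/
theorem SupersolutionOn.transfer_of_monotoneOn (h : SupersolutionOn F V lam v I)
    (hm : MonotoneOn (fun x => v x - a * x) I) (hI : IsOpen I) (hFG : ∀ q, a ≤ q → F q ≤ G q) :
    SupersolutionOn G V lam v I := by
  intro φ hφ y hy hloc
  have hd : a ≤ deriv φ y := by
    refine ge_of_hasDerivAt_of_eventually_left
      (hφ.differentiable one_ne_zero y).hasDerivAt ?_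
    filter_upwards [nhdsWithin_le_nhds hloc, nhdsWithin_le_nhds (hI.mem_nhds hy),
      self_mem_nhdsWithin] with x h1 h2 (h3 : x < y)
    have := hm h2 hy h3.le
    simp only at this h1
    linarith
  linarith [h φ hφ y hy hloc, hFG _ hd]

/-- A test function touching from below has right difference quotients dominated by those of `v`, so
its derivative is at most `a`. -/
theorem SupersolutionOn.transfer_of_antitoneOn (h : SupersolutionOn F V lam v I)
    (hm : AntitoneOn (fun x => v x - a * x) I) (hI : IsOpen I) (hFG : ∀ q, q ≤ a → F q ≤ G q) :
    SupersolutionOn G V lam v I := by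
  intro φ hφ y hy hloc
  have hd : deriv φ y ≤ a := by
    refine le_of_hasDerivAt_of_eventually_right
      (hφ.differentiable one_ne_zero y).hasDerivAt ?_
    filter_upwards [nhdsWithin_le_nhds hloc, nhdsWithin_le_nhds (hI.mem_nhds hy),
      self_mem_nhdsWithin] with x h1 h2 (h3 : y < x)
    have := hm hy h2 h3.le
    simp only at this h1
    linarith
  linarith [h φ hφ y hy hloc, hFG _ hd]

/-- For touching from above, the same bound on the derivative is read off on the left. -/
theorem SubsolutionOn.transfer_of_antitoneOn (h : SubsolutionOn F V lam v I)
    (hm : AntitoneOn (fun x => v x - a * x) I) (hI : IsOpen I) (hFG : ∀ q, q ≤ a → G q ≤ F q) :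
    SubsolutionOn G V lam v I := by
  intro φ hφ y hy hloc
  have hd : deriv φ y ≤ a := by
    refine le_of_hasDerivAt_of_eventually_left
      (hφ.differentiable one_ne_zero y).hasDerivAt ?_
    filter_upwards [nhdsWithin_le_nhds hloc, nhdsWithin_le_nhds (hI.mem_nhds hy),
      self_mem_nhdsWithin] with x h1 h2 (h3 : x < y)
    have := hm h2 hy h3.le
    simp only at this h1
    linarith
  linarith [h φ hφ y hy hloc, hFG _ hd]

/-- The linear function `a * x` is itself an admissible test function. -/
theorem SupersolutionOn.not_isLocalMin (h : SupersolutionOn F V lam v I)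
    {y : ℝ} (hy : y ∈ I) (hlt : F a < -(lam * v y) - V y) :
    ¬ IsLocalMin (fun x => v x - a * x) y := by
  intro hloc
  have := h (fun x => a * x) (by fun_prop) y hy hloc
  rw [deriv_const_mul_id] at this
  linarith

theorem SubsolutionOn.not_isLocalMax (h : SubsolutionOn F V lam v I)
    {y : ℝ} (hy : y ∈ I) (hlt : -(lam * v y) - V y < F a) :
    ¬ IsLocalMax (fun x => v x - a * x) y := by
  intro hloc
  have := h (fun x => a * x) (by fun_prop) y hy hloc
  rw [deriv_const_mul_id] at this
  linarith

end Transfer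

/-! ### Existence of cell solutions by a monotone difference scheme -/

section Scheme

open BoundedContinuousFunction

variable {F : ℝ → ℝ} {K : ℝ}

/-- The numerical viscosity, with coefficient the Lipschitz constant `K`, dominates the variation of
`F`; this makes the scheme monotone. -/
theorem scheme_le (hK0 : 0 ≤ K) (hK : ∀ a b, |F a - F b| ≤ K * |a - b|) {α : ℝ} (hα : 0 ≤ α)
    {a b a' b' : ℝ} (ha : a ≤ a') (hb : b ≤ b') :
    K * α * (a + b) - F (α * (a - b)) ≤ K * α * (a' + b') - F (α * (a' - b')) := by
  have h1 := (abs_le.1 (hK (α * (a' - b')) (α * (a - b)))).2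
  have h2 : |α * (a' - b') - α * (a - b)| ≤ α * ((a' - a) + (b' - b)) := by
    rw [← mul_sub, abs_mul, abs_of_nonneg hα]
    refine mul_le_mul_of_nonneg_left (abs_le.2 ⟨by linarith, by linarith⟩) hα
  have h3 := mul_le_mul_of_nonneg_left h2 hK0
  linarith

/-- Adding `d` to both neighbours leaves their difference unchanged and raises the expression by
exactly `2 * K * α * d`; monotonicity does the rest. -/
theorem scheme_abs_sub_le (hK0 : 0 ≤ K) (hK : ∀ a b, |F a - F b| ≤ K * |a - b|) {α : ℝ}
    (hα : 0 ≤ α) {a b a' b' d : ℝ} (ha : |a - a'| ≤ d) (hb : |b - b'| ≤ d) :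
    |(K * α * (a + b) - F (α * (a - b))) - (K * α * (a' + b') - F (α * (a' - b')))|
      ≤ 2 * K * α * d := by
  obtain ⟨ha1, ha2⟩ := abs_le.1 ha
  obtain ⟨hb1, hb2⟩ := abs_le.1 hb
  have h1 := scheme_le hK0 hK hα (show a ≤ a' + d by linarith) (show b ≤ b' + d by linarith)
  have h2 := scheme_le hK0 hK hα (show a' ≤ a + d by linarith) (show b' ≤ b + d by linarith)
  rw [add_sub_add_right_eq_sub] at h1 h2
  exact abs_le.2 ⟨by linarith, by linarith⟩

/-- The Lax–Friedrichs scheme for `lam * v + F (v') + V = 0` with mesh `1 / (2 * α)` has a bounded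
continuous solution. -/
theorem exists_scheme_solution (hK0 : 0 ≤ K) (hK : ∀ a b, |F a - F b| ≤ K * |a - b|)
    {V : ℝ → ℝ} (hV : Continuous V) {C : ℝ} (hC : ∀ x, |V x| ≤ C) {lam α h : ℝ} (hlam : 0 < lam)
    (hα : 0 ≤ α) :
    ∃ v : ℝ →ᵇ ℝ, ∀ x, (lam + 2 * K * α) * v x =
      K * α * (v (x + h) + v (x - h)) - F (α * (v (x + h) - v (x - h))) - V x := by
  have hFc : Continuous F := by
    refine (LipschitzWith.of_dist_le_mul (K := K.toNNReal) fun a b => ?_).continuous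
    rw [Real.dist_eq, Real.dist_eq, Real.coe_toNNReal _ hK0]
    exact hK a b
  set A : ℝ := 2 * K * α with hA
  have hA0 : 0 ≤ A := by positivity
  have hlA : 0 < lam + A := by positivity
  let T : (ℝ →ᵇ ℝ) → (ℝ →ᵇ ℝ) := fun v => BoundedContinuousFunction.ofNormedAddCommGroup
    (fun x => (K * α * (v (x + h) + v (x - h)) - F (α * (v (x + h) - v (x - h))) - V x)
      / (lam + A))
    (by fun_prop) ((A * ‖v‖ + |F 0| + C) / (lam + A)) (by
      intro x
      rw [norm_div, Real.norm_eq_abs, Real.norm_eq_abs, abs_of_pos hlA]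
      refine div_le_div_of_nonneg_right ?_ hlA.le
      have h1 := scheme_abs_sub_le hK0 hK hα (a := v (x + h)) (b := v (x - h)) (a' := 0) (b' := 0)
        (d := ‖v‖) (by simpa using v.norm_coe_le_norm _) (by simpa using v.norm_coe_le_norm _)
      have h2 := hC x
      simp only [add_zero, mul_zero, sub_zero, zero_sub, sub_neg_eq_add] at h1
      have h3 := abs_le.1 h1
      have h4 := abs_le.1 h2
      have h5 := neg_abs_le (F 0)
      have h6 := le_abs_self (F 0)
      exact abs_le.2 ⟨by linarith, by linarith⟩)
  -- The zeroth-order term `lam > 0` brings the contraction factor `A / (lam + A)` below one.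
  have hT : ContractingWith (A / (lam + A)).toNNReal T := by
    constructor
    · rw [Real.toNNReal_lt_one, div_lt_one hlA]; linarith
    · refine LipschitzWith.of_dist_le_mul fun v w => ?_
      rw [Real.coe_toNNReal _ (by positivity)]
      rw [BoundedContinuousFunction.dist_le (by positivity)]
      intro x
      have h1 := scheme_abs_sub_le hK0 hK hα (a := v (x + h)) (b := v (x - h)) (a' := w (x + h))
        (b' := w (x - h)) (d := dist v w)
        (by simpa [Real.dist_eq] using BoundedContinuousFunction.dist_coe_le_dist (f := v) (g := w) (x + h))
        (by simpa [Real.dist_eq] using BoundedContinuousFunction.dist_coe_le_dist (f := v) (g := w) (x - h))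
      change dist ((_ : ℝ) / (lam + A)) ((_ : ℝ) / (lam + A)) ≤ _
      rw [Real.dist_eq, ← sub_div, abs_div, abs_of_pos hlA, div_mul_eq_mul_div]
      refine div_le_div_of_nonneg_right ?_ hlA.le
      rwa [sub_sub_sub_cancel_right]
  refine ⟨hT.fixedPoint T, fun x => ?_⟩
  have h1 : T (hT.fixedPoint T) = hT.fixedPoint T := hT.fixedPoint_isFixedPt
  have h2 := congrArg (fun f : ℝ →ᵇ ℝ => f x) h1
  have h3 : (K * α * (hT.fixedPoint T (x + h) + hT.fixedPoint T (x - h))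
      - F (α * (hT.fixedPoint T (x + h) - hT.fixedPoint T (x - h))) - V x) / (lam + A)
      = hT.fixedPoint T x := h2
  rw [div_eq_iff hlA.ne'] at h3
  rw [h3, mul_comm]

/-- A translate of `v` solves the scheme with translated `V`, so the contraction estimate bounds the
modulus of continuity by that of `V` over `lam`. The bound does not depend on the mesh, which gives
equicontinuity. -/
theorem scheme_translate_le (hK0 : 0 ≤ K) (hK : ∀ a b, |F a - F b| ≤ K * |a - b|)
    {V : ℝ → ℝ} {lam α h : ℝ} (hlam : 0 < lam) (hα : 0 ≤ α) {v : ℝ →ᵇ ℝ}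
    (hv : ∀ x, (lam + 2 * K * α) * v x =
      K * α * (v (x + h) + v (x - h)) - F (α * (v (x + h) - v (x - h))) - V x)
    {z ω : ℝ} (hω : ∀ x, |V (x + z) - V x| ≤ ω) (x : ℝ) : |v (x + z) - v x| ≤ ω / lam := by
  have hω0 : 0 ≤ ω := (abs_nonneg _).trans (hω 0)
  have hA0 : 0 ≤ 2 * K * α := by positivity
  set f : ℝ →ᵇ ℝ := v.compContinuous ⟨fun x => x + z, by fun_prop⟩ - v with hf
  have hfx : ∀ x, f x = v (x + z) - v x := fun x => rfl
  have key : ∀ x, |f x| ≤ (2 * K * α * ‖f‖ + ω) / (lam + 2 * K * α) := by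
    intro x
    rw [le_div_iff₀ (by positivity), mul_comm, ← abs_of_pos (by positivity : 0 < lam + 2 * K * α),
      ← abs_mul, hfx, mul_sub, hv, hv]
    have h1 := scheme_abs_sub_le hK0 hK hα (a := v (x + z + h)) (b := v (x + z - h))
      (a' := v (x + h)) (b' := v (x - h)) (d := ‖f‖)
      (by have := f.norm_coe_le_norm (x + h); rwa [hfx, Real.norm_eq_abs, add_right_comm] at this)
      (by have := f.norm_coe_le_norm (x - h); rwa [hfx, Real.norm_eq_abs, sub_add_eq_add_sub] at this)
    have h2 := abs_le.1 h1
    have h3 := abs_le.1 (hω x)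
    exact abs_le.2 ⟨by linarith, by linarith⟩
  have hn : ‖f‖ ≤ (2 * K * α * ‖f‖ + ω) / (lam + 2 * K * α) :=
    (BoundedContinuousFunction.norm_le (by positivity)).2 key
  rw [le_div_iff₀ (by positivity)] at hn
  rw [le_div_iff₀ hlam, ← hfx]
  have := f.norm_coe_le_norm x
  rw [Real.norm_eq_abs] at this
  nlinarith [mul_le_mul_of_nonneg_right this hlam.le]

theorem scheme_bound (hK0 : 0 ≤ K) (hK : ∀ a b, |F a - F b| ≤ K * |a - b|)
    {V : ℝ → ℝ} {C : ℝ} (hC : ∀ x, |V x| ≤ C) {lam α h : ℝ} (hlam : 0 < lam) (hα : 0 ≤ α)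
    {v : ℝ →ᵇ ℝ} (hv : ∀ x, (lam + 2 * K * α) * v x =
      K * α * (v (x + h) + v (x - h)) - F (α * (v (x + h) - v (x - h))) - V x)
    (x : ℝ) : |v x| ≤ (|F 0| + C) / lam := by
  have hC0 : 0 ≤ C := (abs_nonneg _).trans (hC 0)
  have hA0 : 0 ≤ 2 * K * α := by positivity
  have key : ∀ x, |v x| ≤ (2 * K * α * ‖v‖ + (|F 0| + C)) / (lam + 2 * K * α) := by
    intro x
    rw [le_div_iff₀ (by positivity), mul_comm, ← abs_of_pos (by positivity : 0 < lam + 2 * K * α),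
      ← abs_mul, hv]
    have h1 := scheme_abs_sub_le hK0 hK hα (a := v (x + h)) (b := v (x - h)) (a' := 0) (b' := 0)
      (d := ‖v‖) (by simpa using v.norm_coe_le_norm _) (by simpa using v.norm_coe_le_norm _)
    simp only [add_zero, mul_zero, sub_zero, zero_sub, sub_neg_eq_add] at h1
    have h3 := abs_le.1 h1
    have h4 := abs_le.1 (hC x)
    have h5 := neg_abs_le (F 0)
    have h6 := le_abs_self (F 0)
    exact abs_le.2 ⟨by linarith, by linarith⟩
  have hn : ‖v‖ ≤ (2 * K * α * ‖v‖ + (|F 0| + C)) / (lam + 2 * K * α) :=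
    (BoundedContinuousFunction.norm_le (by positivity)).2 key
  rw [le_div_iff₀ (by positivity)] at hn
  rw [le_div_iff₀ hlam]
  have := v.norm_coe_le_norm x
  rw [Real.norm_eq_abs] at this
  nlinarith [mul_le_mul_of_nonneg_right this hlam.le]

end Scheme

/-- Limits of solutions of the Lax–Friedrichs schemes are viscosity subsolutions. -/
theorem subsolutionOn_of_scheme_limit {F V : ℝ → ℝ} {K lam : ℝ} (hK0 : 0 ≤ K)
    (hK : ∀ a b, |F a - F b| ≤ K * |a - b|) (hV : Continuous V) {l : Ultrafilter ℕ}
    {h : ℕ → ℝ} (hh : ∀ n, 0 < h n) (hh0 : Tendsto h l (𝓝 0)) {v : ℕ → ℝ → ℝ} {w : ℝ → ℝ}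
    (hvc : ∀ n, Continuous (v n))
    (hv : ∀ n x, (lam + 2 * K * (1 / (2 * h n))) * v n x =
      K * (1 / (2 * h n)) * (v n (x + h n) + v n (x - h n))
        - F (1 / (2 * h n) * (v n (x + h n) - v n (x - h n))) - V x)
    (hlim : ∀ x, Tendsto (fun n => v n x) l (𝓝 (w x)))
    (heq : ∀ ε > 0, ∃ δ > 0, ∀ n x y, |x - y| < δ → |v n x - v n y| ≤ ε) :
    SubsolutionOn F V lam w univ := by
  have hFc : Continuous F := by
    refine (LipschitzWith.of_dist_le_mul (K := K.toNNReal) fun a b => ?_).continuous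
    rw [Real.dist_eq, Real.dist_eq, Real.coe_toNNReal _ hK0]
    exact hK a b
  intro φ₀ hφ₀ y _ hloc
  obtain ⟨ρ, hρ, hball⟩ := Metric.eventually_nhds_iff.1 hloc
  set r := ρ / 2 with hr
  have hr0 : 0 < r := by positivity
  -- The quadratic term makes the maximum strict without changing the derivative at `y`, so the
  -- maximizers `z n` must converge to `y`.
  set φ : ℝ → ℝ := fun x => φ₀ x + (x - y) ^ 2 with hφdef
  have hφ : ContDiff ℝ 1 φ := by fun_prop
  have hdφ : deriv φ y = deriv φ₀ y := by
    have : HasDerivAt φ (deriv φ₀ y + 2 * (y - y) ^ 1 * 1) y := by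
      simpa using (hφ₀.differentiable one_ne_zero y).hasDerivAt.fun_add
        (((hasDerivAt_id y).sub_const y).pow 2)
    rw [this.deriv]; ring
  have hstrict : ∀ x ∈ Icc (y - r) (y + r), x ≠ y → w x - φ x < w y - φ y := by
    intro x hx hxy
    have h1 : dist x y < ρ := by
      rw [Real.dist_eq, abs_lt]; constructor <;> linarith [hx.1, hx.2]
    have h2 := hball h1
    have h3 : 0 < (x - y) ^ 2 := by have := sub_ne_zero.2 hxy; positivity
    simp only [hφdef, sub_self]
    nlinarith
  have hex : ∀ n, ∃ z ∈ Icc (y - r) (y + r),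
      IsMaxOn (fun x => v n x - φ x) (Icc (y - r) (y + r)) z := fun n =>
    isCompact_Icc.exists_isMaxOn (nonempty_Icc.2 (by linarith))
      (((hvc n).sub hφ.continuous).continuousOn)
  choose z hz hmax using hex
  obtain ⟨z', hz', hzt⟩ : ∃ z' ∈ Icc (y - r) (y + r), Tendsto z l (𝓝 z') := by
    obtain ⟨z', h1, h2⟩ := (isCompact_Icc (a := y - r) (b := y + r)).ultrafilter_le_nhds
      (l.map z) (le_principal_iff.2 (Filter.mem_map.2 (univ_mem' hz)))
    exact ⟨z', h1, h2⟩
  have hvz : Tendsto (fun n => v n (z n)) l (𝓝 (w z')) := by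
    rw [Metric.tendsto_nhds]
    intro ε hε
    obtain ⟨δ, hδ, hδ'⟩ := heq (ε / 2) (by positivity)
    filter_upwards [Metric.tendsto_nhds.1 hzt δ hδ, Metric.tendsto_nhds.1 (hlim z') (ε / 2)
      (by positivity)] with n h1 h2
    have h3 := hδ' n (z n) z' h1
    calc dist (v n (z n)) (w z') ≤ dist (v n (z n)) (v n z') + dist (v n z') (w z') :=
          dist_triangle _ _ _
      _ < ε := by rw [Real.dist_eq (v n (z n))]; linarith
  have hφz : Tendsto (fun n => φ (z n)) l (𝓝 (φ z')) := (hφ.continuous.tendsto z').comp hzt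
  have hzy : z' = y := by
    by_contra hne
    have h1 : w y - φ y ≤ w z' - φ z' :=
      le_of_tendsto_of_tendsto ((hlim y).sub_const (φ y)) (hvz.sub hφz)
        (Eventually.of_forall fun n => hmax n ⟨by linarith, by linarith⟩)
    linarith [hstrict z' hz' hne]
  rw [hzy] at hzt hvz
  have hsd : HasStrictDerivAt φ (deriv φ y) y := by
    have := hφ.contDiffAt.hasStrictDerivAt (x := y) one_ne_zero
    exact this
  have hinv : ∀ n, 2 * (1 / (2 * h n)) * h n = 1 := fun n => by
    have := (hh n).ne'
    field_simp
  -- Strict differentiability is needed because the base points `z n` move with the mesh.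
  have hslope : ∀ a b : ℕ → ℝ, Tendsto a l (𝓝 y) → Tendsto b l (𝓝 y) → ∀ c : ℝ,
      (∀ n, a n - b n = c * h n) →
      Tendsto (fun n => 1 / (2 * h n) * (φ (a n) - φ (b n))) l (𝓝 (c / 2 * deriv φ y)) := by
    intro a b ha hb c hc
    have h1 := (hsd.isLittleO.comp_tendsto (ha.prodMk_nhds hb))
    have h2 : (fun n => φ (a n) - φ (b n) - c * h n * deriv φ y) =o[(l : Filter ℕ)]
        (fun n => h n) := by
      have h3 : (fun n => a n - b n) =O[(l : Filter ℕ)] (fun n => h n) :=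
        Asymptotics.IsBigO.of_bound |c| (Eventually.of_forall fun n => by
          rw [hc, norm_mul, Real.norm_eq_abs])
      refine (Asymptotics.IsLittleO.trans_isBigO ?_ h3)
      refine h1.congr (fun n => ?_) (fun n => rfl)
      simp [← hc]
    have h4 := (h2.tendsto_div_nhds_zero.mul_const (1 / 2 : ℝ)).add_const (c / 2 * deriv φ y)
    rw [zero_mul, zero_add] at h4
    refine h4.congr fun n => ?_
    have := (hh n).ne'
    field_simp
    ring
  have hzp : Tendsto (fun n => z n + h n) l (𝓝 y) := by simpa using hzt.add hh0
  have hzm : Tendsto (fun n => z n - h n) l (𝓝 y) := by simpa using hzt.sub hh0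
  have hP := hslope _ _ hzp hzt 1 (fun n => by ring)
  have hM := hslope _ _ hzm hzt (-1) (fun n => by ring)
  -- In the limit the two one-sided slopes are opposite, so the numerical viscosity disappears while
  -- their difference gives `deriv φ y`.
  have hfin : lam * w y ≤ K * (1 / 2 * deriv φ y + -1 / 2 * deriv φ y)
      - F (1 / 2 * deriv φ y - -1 / 2 * deriv φ y) - V y := by
    have hIcc : Icc (y - r) (y + r) ∈ 𝓝 y := Icc_mem_nhds (by linarith) (by linarith)
    refine le_of_tendsto_of_tendsto (hvz.const_mul lam)
      ((((hP.add hM).const_mul K).sub ((hFc.tendsto _).comp (hP.sub hM))).sub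
        ((hV.tendsto y).comp hzt)) ?_
    filter_upwards [hzp hIcc, hzm hIcc] with n h1 h2
    have e1 : v n (z n + h n) - φ (z n + h n) ≤ v n (z n) - φ (z n) := hmax n h1
    have e2 : v n (z n - h n) - φ (z n - h n) ≤ v n (z n) - φ (z n) := hmax n h2
    have hα : 0 ≤ 1 / (2 * h n) := by have := hh n; positivity
    -- At a maximum of `v n - φ`, monotonicity of the scheme permits replacing the increments of `v
    -- n` by those of `φ`.
    have e3 := scheme_le hK0 hK hα
      (show v n (z n + h n) ≤ v n (z n) + (φ (z n + h n) - φ (z n)) by linarith)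
      (show v n (z n - h n) ≤ v n (z n) + (φ (z n - h n) - φ (z n)) by linarith)
    have e4 := hv n (z n)
    have e5 : 1 / (2 * h n) * (v n (z n) + (φ (z n + h n) - φ (z n))
        - (v n (z n) + (φ (z n - h n) - φ (z n))))
        = 1 / (2 * h n) * (φ (z n + h n) - φ (z n)) - 1 / (2 * h n) * (φ (z n - h n) - φ (z n)) := by
      ring
    rw [e5] at e3
    simp only [Function.comp_apply]
    linarith
  have e1 : 1 / 2 * deriv φ y - -1 / 2 * deriv φ y = deriv φ₀ y := by rw [hdφ]; ring
  rw [e1] at hfin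
  linarith

/-- Reflection `v ↦ -v` exchanges touching from above and below, so only the subsolution half of the
limit needs a direct proof. -/
theorem SubsolutionOn.neg {F V v : ℝ → ℝ} {lam : ℝ} {I : Set ℝ}
    (h : SubsolutionOn (fun q => -F (-q)) (fun x => -V x) lam (fun x => -v x) I) :
    SupersolutionOn F V lam v I := by
  intro φ hφ y hy hloc
  have h1 := h (fun x => -φ x) hφ.neg y hy (by
    have := hloc.neg
    refine this.congr (Eventually.of_forall fun x => ?_)
    ring)
  simp only [deriv.fun_neg, neg_neg] at h1
  linarith

/-- Existence of bounded continuous viscosity solutions of the cell problem. -/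
theorem exists_isCellSolution {H : ℝ → ℝ} {K : ℝ} (hK0 : 0 ≤ K)
    (hK : ∀ a b, |H a - H b| ≤ K * |a - b|) (V : BUC) (p : ℝ) {lam : ℝ} (hlam : 0 < lam) :
    ∃ v, IsCellSolution H V p lam v := by
  obtain ⟨C, hC⟩ := V.2.2
  have hVu := V.2.1
  set F : ℝ → ℝ := fun q => H (p + q) with hF
  have hFK : ∀ a b, |F a - F b| ≤ K * |a - b| := fun a b => by
    simpa using hK (p + a) (p + b)
  set h : ℕ → ℝ := fun n => 1 / ((n : ℝ) + 1) with hh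
  have hhp : ∀ n, 0 < h n := fun n => by simp only [hh]; positivity
  have hex := fun n => exists_scheme_solution hK0 hFK hVu.continuous hC (h := h n) hlam
    (α := 1 / (2 * h n)) (by have := hhp n; positivity)
  choose v hv using hex
  have hbd : ∀ n x, v n x ∈ Icc (-((|F 0| + C) / lam)) ((|F 0| + C) / lam) := fun n x =>
    abs_le.1 (scheme_bound hK0 hFK hC hlam (by have := hhp n; positivity) (hv n) x)
  have hlimex : ∀ x, ∃ c ∈ Icc (-((|F 0| + C) / lam)) ((|F 0| + C) / lam),
      Tendsto (fun n => v n x) (hyperfilter ℕ : Filter ℕ) (𝓝 c) := fun x =>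
    exists_tendsto_hyperfilter fun n => hbd n x
  choose w hw hlim using hlimex
  have heq : ∀ ε > 0, ∃ δ > 0, ∀ n x y, |x - y| < δ → |v n x - v n y| ≤ ε := by
    intro ε hε
    obtain ⟨δ, hδ, hδ'⟩ := Metric.uniformContinuous_iff.1 hVu (ε * lam) (by positivity)
    refine ⟨δ, hδ, fun n x y hxy => ?_⟩
    have h1 := scheme_translate_le hK0 hFK hlam (by have := hhp n; positivity) (hv n)
      (z := x - y) (ω := ε * lam) (fun t => by
        have h2 : dist (t + (x - y)) t < δ := by simpa [Real.dist_eq] using hxy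
        exact (hδ' h2).le) y
    rwa [add_sub_cancel, mul_div_assoc, div_self hlam.ne', mul_one] at h1
  have hh0 : Tendsto h (hyperfilter ℕ : Filter ℕ) (𝓝 0) :=
    tendsto_one_div_add_atTop_nhds_zero_nat.mono_left Nat.hyperfilter_le_atTop
  have hwc : Continuous w := by
    rw [Metric.continuous_iff]
    intro y ε hε
    obtain ⟨δ, hδ, hδ'⟩ := heq (ε / 2) (by positivity)
    refine ⟨δ, hδ, fun x hx => ?_⟩
    have : |w x - w y| ≤ ε / 2 := le_of_tendsto ((hlim x).sub (hlim y)).abs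
      (Eventually.of_forall fun n => hδ' n x y hx)
    rw [Real.dist_eq]; linarith
  have hsub : SubsolutionOn F V lam w univ :=
    subsolutionOn_of_scheme_limit hK0 hFK hVu.continuous hhp hh0 (fun n => (v n).continuous) hv
      hlim heq
  have hsup : SupersolutionOn F V lam w univ := by
    refine SubsolutionOn.neg (subsolutionOn_of_scheme_limit (v := fun n x => -v n x) hK0 ?_
      hVu.continuous.neg hhp hh0 (fun n => (v n).continuous.neg) ?_ (fun x => (hlim x).neg) ?_)
    · intro a b
      have := hFK (-b) (-a)
      rw [show -b - -a = a - b by ring] at this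
      rwa [show -F (-a) - -F (-b) = F (-b) - F (-a) by ring]
    · intro n x
      have := hv n x
      rw [show -(1 / (2 * h n) * (-v n (x + h n) - -v n (x - h n)))
        = 1 / (2 * h n) * (v n (x + h n) - v n (x - h n)) by ring, Pi.neg_apply]
      linarith
    · intro ε hε
      obtain ⟨δ, hδ, hδ'⟩ := heq ε hε
      refine ⟨δ, hδ, fun n x y hxy => ?_⟩
      have := hδ' n x y hxy
      rwa [show -v n x - -v n y = -(v n x - v n y) by ring, abs_neg]
  exact ⟨w, hwc, ⟨_, fun y => abs_le.2 (hw y)⟩,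
    fun φ hφ y hm => hsub φ hφ y (mem_univ y) hm, fun φ hφ y hm => hsup φ hφ y (mem_univ y) hm⟩

/-! ### Uniqueness, bounds and dependence on `p` of cell solutions -/

section CellBounds

variable {H : ℝ → ℝ} {K lam : ℝ}

theorem lipschitz_shift (hK : ∀ a b, |H a - H b| ≤ K * |a - b|) (p : ℝ) (a b : ℝ) :
    |H (p + a) - H (p + b)| ≤ K * |a - b| := by simpa using hK (p + a) (p + b)

theorem BUC.continuous (V : BUC) : Continuous V := V.2.1.continuous

/-- Replacing `p` by `p'` perturbs the Hamiltonian by at most `K * |p - p'|`, which serves as `η` in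
the comparison. -/
theorem IsCellSolution.sub_le {V : BUC} {p p' : ℝ} {v w : ℝ → ℝ} (hK0 : 0 ≤ K)
    (hK : ∀ a b, |H a - H b| ≤ K * |a - b|) (hlam : 0 < lam) (hv : IsCellSolution H V p lam v)
    (hw : IsCellSolution H V p' lam w) (y : ℝ) : lam * (v y - w y) ≤ K * |p - p'| := by
  obtain ⟨C, hC⟩ := hv.bounded
  obtain ⟨D, hD⟩ := hw.bounded
  refine comparison_univ (B := C + D) hlam hK0 (by positivity) (lipschitz_shift hK p) (fun q => ?_)
    V.continuous hv.continuous hw.continuous (hv.subsolutionOn univ) (hw.supersolutionOn univ)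
    (fun x => ?_) y
  · have := (abs_le.1 (hK (p + q) (p' + q))).1
    rw [add_sub_add_right_eq_sub] at this
    linarith
  · linarith [(abs_le.1 (hC x)).2, (abs_le.1 (hD x)).1]

theorem IsCellSolution.abs_sub_le {V : BUC} {p p' : ℝ} {v w : ℝ → ℝ} (hK0 : 0 ≤ K)
    (hK : ∀ a b, |H a - H b| ≤ K * |a - b|) (hlam : 0 < lam) (hv : IsCellSolution H V p lam v)
    (hw : IsCellSolution H V p' lam w) (y : ℝ) : |lam * v y - lam * w y| ≤ K * |p - p'| := by
  have h1 := hv.sub_le hK0 hK hlam hw y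
  have h2 := hw.sub_le hK0 hK hlam hv y
  rw [abs_sub_comm] at h2
  exact abs_le.2 ⟨by linarith, by linarith⟩

theorem IsCellSolution.unique {V : BUC} {p : ℝ} {v w : ℝ → ℝ} (hK0 : 0 ≤ K)
    (hK : ∀ a b, |H a - H b| ≤ K * |a - b|) (hlam : 0 < lam) (hv : IsCellSolution H V p lam v)
    (hw : IsCellSolution H V p lam w) : v = w := by
  funext y
  have h := hv.abs_sub_le hK0 hK hlam hw y
  rw [sub_self, abs_zero, mul_zero] at h
  exact mul_left_cancel₀ hlam.ne' (sub_eq_zero.1 (abs_nonpos_iff.1 h))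

theorem deriv_eq_zero_of_isLocalExtr_const_sub {φ : ℝ → ℝ} {c y : ℝ}
    (h : IsLocalExtr (fun x => c - φ x) y) : deriv φ y = 0 := by
  have := h.deriv_eq_zero
  rwa [deriv_const_sub, neg_eq_zero] at this

theorem supersolutionOn_const {F V : ℝ → ℝ} {c : ℝ} (h : ∀ x, 0 ≤ lam * c + F 0 + V x)
    (I : Set ℝ) : SupersolutionOn F V lam (fun _ => c) I := by
  intro φ _ y _ hm
  rw [deriv_eq_zero_of_isLocalExtr_const_sub (Or.inl hm)]
  exact h y

theorem subsolutionOn_const {F V : ℝ → ℝ} {c : ℝ} (h : ∀ x, lam * c + F 0 + V x ≤ 0)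
    (I : Set ℝ) : SubsolutionOn F V lam (fun _ => c) I := by
  intro φ _ y _ hm
  rw [deriv_eq_zero_of_isLocalExtr_const_sub (Or.inr hm)]
  exact h y

/-- The constant `(-H p - m) / lam` is a supersolution. -/
theorem IsCellSolution.le_of_forall_ge {V : BUC} {p m : ℝ} {v : ℝ → ℝ} (hK0 : 0 ≤ K)
    (hK : ∀ a b, |H a - H b| ≤ K * |a - b|) (hlam : 0 < lam) (hv : IsCellSolution H V p lam v)
    (hV : ∀ x, m ≤ V x) (y : ℝ) : lam * v y ≤ -H p - m := by
  obtain ⟨C, hC⟩ := hv.bounded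
  have h := comparison_univ (F := fun q => H (p + q)) (V := V) (u := v)
    (w := fun _ => (-H p - m) / lam) (B := C - (-H p - m) / lam) hlam hK0 le_rfl
    (lipschitz_shift hK p) (fun q => (add_zero _).ge) V.continuous hv.continuous
    continuous_const (hv.subsolutionOn univ)
    (supersolutionOn_const (fun x => by
      rw [mul_div_cancel₀ _ hlam.ne', add_zero]; linarith [hV x]) univ)
    (fun x => by linarith [(abs_le.1 (hC x)).2]) y
  rw [mul_sub, mul_div_cancel₀ _ hlam.ne'] at h
  linarith

theorem IsCellSolution.ge_of_forall_le {V : BUC} {p m : ℝ} {v : ℝ → ℝ} (hK0 : 0 ≤ K)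
    (hK : ∀ a b, |H a - H b| ≤ K * |a - b|) (hlam : 0 < lam) (hv : IsCellSolution H V p lam v)
    (hV : ∀ x, V x ≤ m) (y : ℝ) : -H p - m ≤ lam * v y := by
  obtain ⟨C, hC⟩ := hv.bounded
  have h := comparison_univ (F := fun q => H (p + q)) (V := V) (w := v)
    (u := fun _ => (-H p - m) / lam) (B := (-H p - m) / lam + C) hlam hK0 le_rfl
    (lipschitz_shift hK p) (fun q => (add_zero _).ge) V.continuous continuous_const hv.continuous
    (subsolutionOn_const (fun x => by
      rw [mul_div_cancel₀ _ hlam.ne', add_zero]; linarith [hV x]) univ)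
    (hv.supersolutionOn univ)
    (fun x => by linarith [(abs_le.1 (hC x)).1]) y
  rw [mul_sub, mul_div_cancel₀ _ hlam.ne'] at h
  linarith

end CellBounds

/-! ### Families of solutions with a uniform limit on balls of radius `R / lam` -/

/-- `lam * v lam → -c` uniformly on the balls of radius `R / lam`, for every `R`. -/
def RescaledLimit (v : ℝ → ℝ → ℝ) (c : ℝ) : Prop :=
  ∀ R : ℝ, 0 < R → ∀ ε : ℝ, 0 < ε → ∀ᶠ lam in 𝓝[>] (0 : ℝ),
    ∀ y ∈ Icc (-(R / lam)) (R / lam), |lam * v lam y + c| ≤ ε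

/-- For every `R`, the functions `lam * v lam` are eventually bounded by `C` on the balls of radius
`R / lam`. -/
def RescaledBound (v : ℝ → ℝ → ℝ) (C : ℝ) : Prop :=
  ∀ R : ℝ, 0 < R → ∀ᶠ lam in 𝓝[>] (0 : ℝ), ∀ y ∈ Icc (-(R / lam)) (R / lam), |lam * v lam y| ≤ C

theorem RescaledLimit.bound {v : ℝ → ℝ → ℝ} {c : ℝ} (h : RescaledLimit v c) :
    RescaledBound v (|c| + 1) := by
  intro R hR
  filter_upwards [h R hR 1 one_pos] with lam hl y hy
  have h1 := abs_le.1 (hl y hy)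
  have h2 := neg_abs_le c
  have h3 := le_abs_self c
  exact abs_le.2 ⟨by linarith, by linarith⟩

/-- On radius `ρ / lam` with `B = E / lam` the errors of `comparison_Icc` become `2 * K * E / ρ` and
`E * R ^ 2 / ρ ^ 2`, free of `lam`; a large `ρ` makes them small. Only information on large balls is
used. -/
theorem eventually_comparison {F V : ℝ → ℝ} {K C D : ℝ} {u w : ℝ → ℝ → ℝ} (hK0 : 0 ≤ K)
    (hK : ∀ a b, |F a - F b| ≤ K * |a - b|) (hV : Continuous V)
    (hu : ∀ lam, 0 < lam → Continuous (u lam)) (hw : ∀ lam, 0 < lam → Continuous (w lam))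
    (hsub : ∀ R : ℝ, 0 < R → ∀ᶠ lam in 𝓝[>] (0 : ℝ),
      SubsolutionOn F V lam (u lam) (Ioo (-(R / lam)) (R / lam)))
    (hsup : ∀ R : ℝ, 0 < R → ∀ᶠ lam in 𝓝[>] (0 : ℝ),
      SupersolutionOn F V lam (w lam) (Ioo (-(R / lam)) (R / lam)))
    (hC : RescaledBound u C) (hD : RescaledBound w D)
    {R ε : ℝ} (hR : 0 < R) (hε : 0 < ε) :
    ∀ᶠ lam in 𝓝[>] (0 : ℝ), ∀ y ∈ Icc (-(R / lam)) (R / lam),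
      lam * (u lam y - w lam y) ≤ ε := by
  set E := max (C + D) 0 with hE
  have h1 : Tendsto (fun ρ : ℝ => 2 * K * E / ρ + E * R ^ 2 / ρ ^ 2) atTop (𝓝 (0 + 0)) :=
    (tendsto_id.const_div_atTop _).add
      (tendsto_const_nhds.div_atTop (tendsto_pow_atTop two_ne_zero))
  rw [add_zero] at h1
  obtain ⟨ρ, hρε, hρR⟩ := ((h1.eventually (gt_mem_nhds hε)).and (eventually_ge_atTop R)).exists
  have hρ : 0 < ρ := hR.trans_le hρR
  filter_upwards [hsub ρ hρ, hsup ρ hρ, hC ρ hρ, hD ρ hρ, self_mem_nhdsWithin]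
    with lam h1 h2 h3 h4 (hlam : 0 < lam) y hy
  have hle : R / lam ≤ ρ / lam := div_le_div_of_nonneg_right hρR hlam.le
  have h5 := comparison_Icc (B := E / lam) (r := ρ / lam) hlam (by positivity) hK0 le_rfl
    (div_nonneg (le_max_right _ _) hlam.le) hK (fun q => (add_zero _).ge) hV (hu lam hlam)
    (hw lam hlam) h1 h2 (fun x hx => by
      rw [le_div_iff₀ hlam]
      have := (abs_le.1 (h3 x hx)).2
      have := (abs_le.1 (h4 x hx)).1
      have := le_max_left (C + D) 0
      linarith) (y₀ := y) ⟨by linarith [hy.1], by linarith [hy.2]⟩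
  refine h5.trans (le_trans ?_ hρε.le)
  have h6 : y ^ 2 ≤ (R / lam) ^ 2 := sq_le_sq' hy.1 hy.2
  have h7 : 0 + 2 * K * (E / lam) / (ρ / lam) = 2 * K * E / ρ := by field_simp; ring
  have h8 : lam * (E / lam / (ρ / lam) ^ 2 * (R / lam) ^ 2) = E * R ^ 2 / ρ ^ 2 := by field_simp
  rw [h7, ← h8]
  have hE0 : 0 ≤ E := le_max_right _ _
  gcongr

theorem RescaledLimit.le {F V : ℝ → ℝ} {K c d : ℝ} {u w : ℝ → ℝ → ℝ} (hK0 : 0 ≤ K)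
    (hK : ∀ a b, |F a - F b| ≤ K * |a - b|) (hV : Continuous V)
    (hu : ∀ lam, 0 < lam → Continuous (u lam)) (hw : ∀ lam, 0 < lam → Continuous (w lam))
    (hsub : ∀ R : ℝ, 0 < R → ∀ᶠ lam in 𝓝[>] (0 : ℝ),
      SubsolutionOn F V lam (u lam) (Ioo (-(R / lam)) (R / lam)))
    (hsup : ∀ R : ℝ, 0 < R → ∀ᶠ lam in 𝓝[>] (0 : ℝ),
      SupersolutionOn F V lam (w lam) (Ioo (-(R / lam)) (R / lam)))
    (hc : RescaledLimit u c) (hd : RescaledLimit w d) : d ≤ c := by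
  refine le_of_forall_pos_le_add fun ε hε => ?_
  obtain ⟨lam, ⟨⟨h1, h2⟩, h3⟩, hlam⟩ := ((((hc 1 one_pos (ε / 3) (by positivity)).and
    (hd 1 one_pos (ε / 3) (by positivity))).and
    (eventually_comparison hK0 hK hV hu hw hsub hsup hc.bound hd.bound one_pos
      (by positivity : 0 < ε / 3))).and self_mem_nhdsWithin).exists
  have hlam' : (0 : ℝ) < lam := hlam
  have h0 : (0 : ℝ) ∈ Icc (-(1 / lam)) (1 / lam) := by
    have : 0 < 1 / lam := by positivity
    exact ⟨by linarith, this.le⟩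
  linarith [(abs_le.1 (h1 0 h0)).1, (abs_le.1 (h2 0 h0)).2, h3 0 h0]

/-! ### Barriers for the slopes of rescaled families -/

section Monotonicity

variable {v : ℝ → ℝ → ℝ} {c b ρ : ℝ}

theorem RescaledLimit.neg (h : RescaledLimit v c) :
    RescaledLimit (fun lam y => -v lam y) (-c) := by
  intro R hR ε hε
  filter_upwards [h R hR ε hε] with lam hl y hy
  rw [show lam * -v lam y + -c = -(lam * v lam y + c) by ring, abs_neg]
  exact hl y hy

/-- On these balls `lam * v` is almost constant, whereas `lam * b * x` varies by at least `|b|`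
between `y` and the far endpoint. Two errors of `|b| / 4` cannot offset that. -/
theorem RescaledLimit.eventually_lt_right (h : RescaledLimit v c) (hb : b < 0) (hρ : 0 < ρ) :
    ∀ᶠ lam in 𝓝[>] (0 : ℝ), ∀ y ∈ Icc (-(ρ / lam)) (ρ / lam),
      v lam y - b * y < v lam ((ρ + 1) / lam) - b * ((ρ + 1) / lam) := by
  filter_upwards [h (ρ + 1) (by positivity) (-b / 4) (by linarith), self_mem_nhdsWithin]
    with lam hl (hlam : 0 < lam) y hy
  have h1 : ρ / lam + 1 / lam = (ρ + 1) / lam := by ring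
  have h2 : 0 < 1 / lam := by positivity
  have h0 : 0 < ρ / lam := by positivity
  have h3 := (abs_le.1 (hl y ⟨by linarith [hy.1], by linarith [hy.2]⟩)).2
  have h4 := (abs_le.1 (hl ((ρ + 1) / lam) ⟨by linarith, le_rfl⟩)).1
  have h5 : lam * ((ρ + 1) / lam) = ρ + 1 := by field_simp
  have h6 : lam * y ≤ ρ := by have := hy.2; rw [le_div_iff₀ hlam] at this; linarith
  refine lt_of_mul_lt_mul_left ?_ hlam.le
  rw [mul_sub, mul_sub, mul_left_comm, mul_left_comm lam b, h5]
  nlinarith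

theorem RescaledLimit.eventually_left_lt (h : RescaledLimit v c) (hb : b < 0) (hρ : 0 < ρ) :
    ∀ᶠ lam in 𝓝[>] (0 : ℝ), ∀ y ∈ Icc (-(ρ / lam)) (ρ / lam),
      v lam (-((ρ + 1) / lam)) - b * (-((ρ + 1) / lam)) < v lam y - b * y := by
  have hr : RescaledLimit (fun lam y => -v lam (-y)) (-c) := by
    intro R hR ε hε
    filter_upwards [h.neg R hR ε hε] with lam hl y hy
    exact hl (-y) ⟨by linarith [hy.2], by linarith [hy.1]⟩
  filter_upwards [hr.eventually_lt_right hb hρ] with lam hl y hy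
  have := hl (-y) ⟨by linarith [hy.2], by linarith [hy.1]⟩
  rw [neg_neg] at this
  linarith

theorem RescaledLimit.eventually_right_lt (h : RescaledLimit v c) (hb : 0 < b) (hρ : 0 < ρ) :
    ∀ᶠ lam in 𝓝[>] (0 : ℝ), ∀ y ∈ Icc (-(ρ / lam)) (ρ / lam),
      v lam ((ρ + 1) / lam) - b * ((ρ + 1) / lam) < v lam y - b * y := by
  filter_upwards [h.neg.eventually_lt_right (neg_lt_zero.2 hb) hρ] with lam hl y hy
  linarith [hl y hy]

theorem RescaledLimit.eventually_lt_left (h : RescaledLimit v c) (hb : 0 < b) (hρ : 0 < ρ) :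
    ∀ᶠ lam in 𝓝[>] (0 : ℝ), ∀ y ∈ Icc (-(ρ / lam)) (ρ / lam),
      v lam y - b * y < v lam (-((ρ + 1) / lam)) - b * (-((ρ + 1) / lam)) := by
  filter_upwards [h.neg.eventually_left_lt (neg_lt_zero.2 hb) hρ] with lam hl y hy
  linarith [hl y hy]

variable {G : ℝ → ℝ} {V : BUC} {p a mbar : ℝ}

/-- As `V ≤ 0`, the level `-lam v - V` is at least about `c`, hence above `G a`. -/
theorem RescaledLimit.eventually_not_isLocalMin (h : RescaledLimit v c)
    (hv : ∀ lam, 0 < lam → IsCellSolution G V p lam (v lam)) (hV : ∀ x, V x ≤ 0)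
    (ha : G a < c) (hρ : 0 < ρ) :
    ∀ᶠ lam in 𝓝[>] (0 : ℝ), ∀ y ∈ Ioo (-(ρ / lam)) (ρ / lam),
      ¬ IsLocalMin (fun x => v lam x - (a - p) * x) y := by
  filter_upwards [h ρ hρ ((c - G a) / 2) (by linarith), self_mem_nhdsWithin]
    with lam hl (hlam : 0 < lam) y hy
  refine ((hv lam hlam).supersolutionOn univ).not_isLocalMin (mem_univ y) ?_
  have h1 := (abs_le.1 (hl y (Ioo_subset_Icc_self hy))).2
  rw [add_sub_cancel]
  linarith [hV y]

/-- As `V ≥ -mbar`, the level `-lam v - V` is at most about `c + mbar`, hence below `G a`. -/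
theorem RescaledLimit.eventually_not_isLocalMax (h : RescaledLimit v c)
    (hv : ∀ lam, 0 < lam → IsCellSolution G V p lam (v lam)) (hV : ∀ x, -mbar ≤ V x)
    (ha : c + mbar < G a) (hρ : 0 < ρ) :
    ∀ᶠ lam in 𝓝[>] (0 : ℝ), ∀ y ∈ Ioo (-(ρ / lam)) (ρ / lam),
      ¬ IsLocalMax (fun x => v lam x - (a - p) * x) y := by
  filter_upwards [h ρ hρ ((G a - c - mbar) / 2) (by linarith), self_mem_nhdsWithin]
    with lam hl (hlam : 0 < lam) y hy
  refine ((hv lam hlam).subsolutionOn univ).not_isLocalMax (mem_univ y) ?_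
  have h1 := (abs_le.1 (hl y (Ioo_subset_Icc_self hy))).1
  rw [add_sub_cancel]
  linarith [hV y]

theorem div_lt_add_one_div {lam : ℝ} (hlam : 0 < lam) (ρ : ℝ) : ρ / lam < (ρ + 1) / lam :=
  div_lt_div_of_pos_right (lt_add_one ρ) hlam

/-- If the level is above `G a` and `p > a`, then all slopes are at least `a`. -/
theorem RescaledLimit.monotoneOn_of_lt (h : RescaledLimit v c)
    (hv : ∀ lam, 0 < lam → IsCellSolution G V p lam (v lam)) (hV : ∀ x, V x ≤ 0)
    (ha : G a < c) (hap : a < p) (hρ : 0 < ρ) :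
    ∀ᶠ lam in 𝓝[>] (0 : ℝ),
      MonotoneOn (fun x => v lam x - (a - p) * x) (Icc (-(ρ / lam)) (ρ / lam)) := by
  filter_upwards [h.eventually_not_isLocalMin hv hV ha (by positivity : 0 < ρ + 1),
    h.eventually_lt_right (sub_neg.2 hap) hρ, self_mem_nhdsWithin] with lam h1 h2 (hlam : 0 < lam)
  have h3 := div_lt_add_one_div hlam ρ
  have h4 := (hv lam hlam).continuous
  exact monotoneOn_of_not_isLocalMin (by fun_prop) h3
    (fun y hy => h1 y ⟨by linarith [hy.1], hy.2⟩) h2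

/-- If the level is above `G a` and `p < a`, then all slopes are at most `a`. -/
theorem RescaledLimit.antitoneOn_of_lt (h : RescaledLimit v c)
    (hv : ∀ lam, 0 < lam → IsCellSolution G V p lam (v lam)) (hV : ∀ x, V x ≤ 0)
    (ha : G a < c) (hap : p < a) (hρ : 0 < ρ) :
    ∀ᶠ lam in 𝓝[>] (0 : ℝ),
      AntitoneOn (fun x => v lam x - (a - p) * x) (Icc (-(ρ / lam)) (ρ / lam)) := by
  filter_upwards [h.eventually_not_isLocalMin hv hV ha (by positivity : 0 < ρ + 1),
    h.eventually_lt_left (sub_pos.2 hap) hρ, self_mem_nhdsWithin] with lam h1 h2 (hlam : 0 < lam)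
  have h3 := div_lt_add_one_div hlam ρ
  have h4 := (hv lam hlam).continuous
  exact antitoneOn_of_not_isLocalMin (by fun_prop) (neg_lt_neg h3)
    (fun y hy => h1 y ⟨hy.1, by linarith [hy.2]⟩) h2

/-- If the level stays below `G a` and `p > a`, then all slopes are at least `a`. -/
theorem RescaledLimit.monotoneOn_of_gt (h : RescaledLimit v c)
    (hv : ∀ lam, 0 < lam → IsCellSolution G V p lam (v lam)) (hV : ∀ x, -mbar ≤ V x)
    (ha : c + mbar < G a) (hap : a < p) (hρ : 0 < ρ) :
    ∀ᶠ lam in 𝓝[>] (0 : ℝ),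
      MonotoneOn (fun x => v lam x - (a - p) * x) (Icc (-(ρ / lam)) (ρ / lam)) := by
  filter_upwards [h.eventually_not_isLocalMax hv hV ha (by positivity : 0 < ρ + 1),
    h.eventually_left_lt (sub_neg.2 hap) hρ, self_mem_nhdsWithin] with lam h1 h2 (hlam : 0 < lam)
  have h3 := div_lt_add_one_div hlam ρ
  have h4 := (hv lam hlam).continuous
  exact monotoneOn_of_not_isLocalMax (by fun_prop) (neg_lt_neg h3)
    (fun y hy => h1 y ⟨hy.1, by linarith [hy.2]⟩) h2

/-- If the level stays below `G a` and `p < a`, then all slopes are at most `a`. -/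
theorem RescaledLimit.antitoneOn_of_gt (h : RescaledLimit v c)
    (hv : ∀ lam, 0 < lam → IsCellSolution G V p lam (v lam)) (hV : ∀ x, -mbar ≤ V x)
    (ha : c + mbar < G a) (hap : p < a) (hρ : 0 < ρ) :
    ∀ᶠ lam in 𝓝[>] (0 : ℝ),
      AntitoneOn (fun x => v lam x - (a - p) * x) (Icc (-(ρ / lam)) (ρ / lam)) := by
  filter_upwards [h.eventually_not_isLocalMax hv hV ha (by positivity : 0 < ρ + 1),
    h.eventually_right_lt (sub_pos.2 hap) hρ, self_mem_nhdsWithin] with lam h1 h2 (hlam : 0 < lam)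
  have h3 := div_lt_add_one_div hlam ρ
  have h4 := (hv lam hlam).continuous
  exact antitoneOn_of_not_isLocalMax (by fun_prop) h3
    (fun y hy => h1 y ⟨by linarith [hy.1], hy.2⟩) h2

end Monotonicity

/-! ### Effective values along a single potential -/

/-- The number `c` is the effective value at `p` along the single potential `V`. -/
def HasValueAt (H : ℝ → ℝ) (V : BUC) (p c : ℝ) : Prop :=
  ∃ v : ℝ → ℝ → ℝ, (∀ lam : ℝ, 0 < lam → IsCellSolution H V p lam (v lam)) ∧ RescaledLimit v c

theorem exists_cell_family {H : ℝ → ℝ} {K : ℝ} (hK0 : 0 ≤ K)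
    (hK : ∀ a b, |H a - H b| ≤ K * |a - b|) (V : BUC) (p : ℝ) :
    ∃ v : ℝ → ℝ → ℝ, ∀ lam : ℝ, 0 < lam → IsCellSolution H V p lam (v lam) := by
  have : ∀ lam : ℝ, ∃ v : ℝ → ℝ, 0 < lam → IsCellSolution H V p lam v := fun lam => by
    by_cases hlam : 0 < lam
    · exact (exists_isCellSolution hK0 hK V p hlam).imp fun v hv _ => hv
    · exact ⟨0, fun h => absurd h hlam⟩
  choose v hv using this
  exact ⟨v, hv⟩

theorem zero_mem_Icc_div {R lam : ℝ} (hR : 0 < R) (hlam : 0 < lam) :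
    (0 : ℝ) ∈ Icc (-(R / lam)) (R / lam) := by
  have : 0 < R / lam := by positivity
  exact ⟨by linarith, this.le⟩

theorem HasValueAt.abs_sub_le {H : ℝ → ℝ} {K : ℝ} {V : BUC} {p p' c c' : ℝ} (hK0 : 0 ≤ K)
    (hK : ∀ a b, |H a - H b| ≤ K * |a - b|) (h : HasValueAt H V p c) (h' : HasValueAt H V p' c') :
    |c - c'| ≤ K * |p - p'| := by
  obtain ⟨v, hv, hc⟩ := h
  obtain ⟨w, hw, hd⟩ := h'
  refine le_of_forall_pos_le_add fun ε hε => ?_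
  obtain ⟨lam, ⟨h1, h2⟩, hlam⟩ := (((hc 1 one_pos (ε / 2) (by positivity)).and
    (hd 1 one_pos (ε / 2) (by positivity))).and self_mem_nhdsWithin).exists
  have hlam' : (0 : ℝ) < lam := hlam
  have h0 := zero_mem_Icc_div one_pos hlam'
  have h3 := abs_le.1 ((hv lam hlam').abs_sub_le hK0 hK hlam' (hw lam hlam') 0)
  have h4 := abs_le.1 (h1 0 h0)
  have h5 := abs_le.1 (h2 0 h0)
  exact abs_le.2 ⟨by linarith, by linarith⟩

/-- Cell solutions times `lam` are `K`-Lipschitz in `p` uniformly in `lam`, so having a value is a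
closed condition. This recovers the exceptional `p` at the thresholds. -/
theorem hasValueAt_of_forall_approx {H : ℝ → ℝ} {K : ℝ} {V : BUC} {p c : ℝ} (hK0 : 0 ≤ K)
    (hK : ∀ a b, |H a - H b| ≤ K * |a - b|)
    (h : ∀ ε > 0, ∃ p' c', HasValueAt H V p' c' ∧ |p - p'| ≤ ε ∧ |c - c'| ≤ ε) :
    HasValueAt H V p c := by
  obtain ⟨v, hv⟩ := exists_cell_family hK0 hK V p
  refine ⟨v, hv, fun R hR ε hε => ?_⟩
  obtain ⟨p', c', ⟨w, hw, hwl⟩, hp, hc⟩ := h (ε / (2 * (K + 1))) (by positivity)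
  filter_upwards [hwl R hR (ε / 2) (by positivity), self_mem_nhdsWithin]
    with lam h1 (hlam : 0 < lam) y hy
  have h2 := abs_le.1 ((hv lam hlam).abs_sub_le hK0 hK hlam (hw lam hlam) y)
  have h3 := abs_le.1 (h1 y hy)
  have h4 := abs_le.1 hc
  have h5 := mul_le_mul_of_nonneg_left hp hK0
  have h6 : K * (ε / (2 * (K + 1))) + ε / (2 * (K + 1)) = ε / 2 := by field_simp
  exact abs_le.2 ⟨by linarith, by linarith⟩

theorem HasValueAt.le_of_forall_ge {H : ℝ → ℝ} {K : ℝ} {V : BUC} {p c m : ℝ} (hK0 : 0 ≤ K)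
    (hK : ∀ a b, |H a - H b| ≤ K * |a - b|) (h : HasValueAt H V p c) (hV : ∀ x, -m ≤ V x) :
    H p - m ≤ c := by
  obtain ⟨v, hv, hc⟩ := h
  refine le_of_forall_pos_le_add fun ε hε => ?_
  obtain ⟨lam, h1, hlam⟩ := ((hc 1 one_pos ε hε).and self_mem_nhdsWithin).exists
  have hlam' : (0 : ℝ) < lam := hlam
  have h3 := (hv lam hlam').le_of_forall_ge hK0 hK hlam' hV 0
  have h4 := abs_le.1 (h1 0 (zero_mem_Icc_div one_pos hlam'))
  linarith

section Squeeze

variable {H H₁ H₂ : ℝ → ℝ} {K : ℝ} {V : BUC} {p c c₁ c₂ mbar : ℝ}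

/-- The effective value is monotone in the Hamiltonian. -/
theorem HasValueAt.mono (hK0 : 0 ≤ K) (hK : ∀ a b, |H₁ a - H₁ b| ≤ K * |a - b|)
    (h₁ : HasValueAt H₁ V p c₁) (h₂ : HasValueAt H₂ V p c₂) (hle : ∀ q, H₁ q ≤ H₂ q) :
    c₁ ≤ c₂ := by
  obtain ⟨v, hv, hvc⟩ := h₁
  obtain ⟨w, hw, hwc⟩ := h₂
  refine RescaledLimit.le hK0 (lipschitz_shift hK p) V.continuous
    (fun lam hlam => (hw lam hlam).continuous) (fun lam hlam => (hv lam hlam).continuous)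
    (fun R _ => ?_) (fun R _ => ?_) hwc hvc
  · filter_upwards [self_mem_nhdsWithin] with lam (hlam : 0 < lam)
    exact ((hw lam hlam).subsolutionOn _).of_le fun q => hle _
  · filter_upwards [self_mem_nhdsWithin] with lam (hlam : 0 < lam)
    exact (hv lam hlam).supersolutionOn _

/-- If the cell solutions for `H₁ ≥ H` are supersolutions for `H` on large balls, then `H` has the
same effective value as `H₁`. -/
theorem hasValueAt_of_supersolution (hK0 : 0 ≤ K) (hK : ∀ a b, |H a - H b| ≤ K * |a - b|)
    (hV0 : ∀ x, V x ≤ 0) (hVm : ∀ x, -mbar ≤ V x) (hle : ∀ q, H q ≤ H₁ q) {v : ℝ → ℝ → ℝ}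
    (hv : ∀ lam : ℝ, 0 < lam → IsCellSolution H₁ V p lam (v lam)) (hc : RescaledLimit v c)
    (hsup : ∀ R : ℝ, 0 < R → ∀ᶠ lam in 𝓝[>] (0 : ℝ),
      SupersolutionOn (fun q => H (p + q)) V lam (v lam) (Ioo (-(R / lam)) (R / lam))) :
    HasValueAt H V p c := by
  obtain ⟨u, hu⟩ := exists_cell_family hK0 hK V p
  have hub : RescaledBound u (|H p| + |mbar|) := by
    intro R _
    filter_upwards [self_mem_nhdsWithin] with lam (hlam : 0 < lam) y _
    have h1 := (hu lam hlam).le_of_forall_ge hK0 hK hlam hVm y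
    have h2 := (hu lam hlam).ge_of_forall_le hK0 hK hlam hV0 y
    have h3 := neg_abs_le (H p)
    have h4 := le_abs_self (H p)
    have h5 := le_abs_self mbar
    have h6 := abs_nonneg mbar
    exact abs_le.2 ⟨by linarith, by linarith⟩
  refine ⟨u, hu, fun R hR ε hε => ?_⟩
  have hcu : ∀ lam, 0 < lam → Continuous (u lam) := fun lam hlam => (hu lam hlam).continuous
  have hcv : ∀ lam, 0 < lam → Continuous (v lam) := fun lam hlam => (hv lam hlam).continuous
  have e1 := eventually_comparison hK0 (lipschitz_shift hK p) V.continuous hcu hcv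
    (fun R _ => by
      filter_upwards [self_mem_nhdsWithin] with lam (hlam : 0 < lam)
      exact (hu lam hlam).subsolutionOn _) hsup hub hc.bound hR (half_pos hε)
  -- This direction is free: `H ≤ H₁` makes `v` a subsolution for `H`.
  have e2 := eventually_comparison hK0 (lipschitz_shift hK p) V.continuous hcv hcu
    (fun R _ => by
      filter_upwards [self_mem_nhdsWithin] with lam (hlam : 0 < lam)
      exact ((hv lam hlam).subsolutionOn _).of_le fun q => hle _)
    (fun R _ => by
      filter_upwards [self_mem_nhdsWithin] with lam (hlam : 0 < lam)
      exact (hu lam hlam).supersolutionOn _) hc.bound hub hR (half_pos hε)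
  filter_upwards [e1, e2, hc R hR (ε / 2) (half_pos hε)] with lam h1 h2 h3 y hy
  have h4 := abs_le.1 (h3 y hy)
  exact abs_le.2 ⟨by linarith [h2 y hy], by linarith [h1 y hy]⟩

end Squeeze

/-- The deterministic core: away from the two thresholds `a` and `b`, the effective value of `H`
is the minimum of those of `H₁` and `H₂`. -/
theorem hasValueAt_min {H H₁ H₂ H₃ : ℝ → ℝ} {K K₁ K₃ a b mbar p c₁ c₂ c₃ : ℝ} {V : BUC}
    (hK0 : 0 ≤ K) (hK : ∀ x y, |H x - H y| ≤ K * |x - y|)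
    (hK₁0 : 0 ≤ K₁) (hK₁ : ∀ x y, |H₁ x - H₁ y| ≤ K₁ * |x - y|)
    (hK₃0 : 0 ≤ K₃) (hK₃ : ∀ x y, |H₃ x - H₃ y| ≤ K₃ * |x - y|)
    (hV0 : ∀ x, V x ≤ 0) (hVm : ∀ x, -mbar ≤ V x)
    (hba : b < a) (hosc : mbar < H a - H b)
    (h₁ge : ∀ q, H q ≤ H₁ q) (h₁eq : ∀ q, q ≤ a → H₁ q = H q) (h₁a : ∀ q, a ≤ q → H a ≤ H₁ q)
    (h₂ge : ∀ q, H q ≤ H₂ q) (h₂eq : ∀ q, b ≤ q → H₂ q = H q)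
    (h₃eq : ∀ q, H₃ q = max (H₁ q) (H₂ q)) (hpa : p ≠ a) (hpb : p ≠ b)
    (h₁ : HasValueAt H₁ V p c₁) (h₂ : HasValueAt H₂ V p c₂) (h₃ : HasValueAt H₃ V p c₃) :
    HasValueAt H V p (min c₁ c₂) := by
  have h₁₃ : c₁ ≤ c₃ := h₁.mono hK₁0 hK₁ h₃ fun q => by rw [h₃eq]; exact le_max_left _ _
  have hb₁ : H₁ b = H b := h₁eq b hba.le
  have ha₁ : H₁ a = H a := h₁eq a le_rfl
  have hb₂ : H₂ b = H b := h₂eq b le_rfl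
  have ha₂ : H₂ a = H a := h₂eq a hba.le
  have hmin₁ : HasValueAt H V p c₁ → HasValueAt H V p (min c₁ c₂) := fun h => by
    rwa [min_eq_left (h.mono hK0 hK h₂ h₂ge)]
  have hmin₂ : HasValueAt H V p c₂ → HasValueAt H V p (min c₁ c₂) := fun h => by
    rwa [min_eq_right (h.mono hK0 hK h₁ h₁ge)]
  have hle := h₁.le_of_forall_ge hK₁0 hK₁ hVm
  have h₂' := h₂
  obtain ⟨v₁, hv₁, hc₁⟩ := h₁
  obtain ⟨v₂, hv₂, hc₂⟩ := h₂
  -- Low level: `H₁ p - mbar ≤ c₁` forces `p < a`, and `a` bounds the slopes of `v₁` from above,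
  -- where `H₁ = H`.
  rcases lt_or_ge (c₁ + mbar) (H a) with hlow | hhigh
  · have hp : p < a := by
      by_contra! hp
      linarith [h₁a p hp]
    refine hmin₁ (hasValueAt_of_supersolution hK0 hK hV0 hVm h₁ge hv₁ hc₁ fun R hR => ?_)
    filter_upwards [hc₁.antitoneOn_of_gt hv₁ hVm (by rwa [ha₁]) hp hR, self_mem_nhdsWithin]
      with lam hm (hlam : 0 < lam)
    exact ((hv₁ lam hlam).supersolutionOn _).transfer_of_antitoneOn
      (hm.mono Ioo_subset_Icc_self) isOpen_Ioo fun q hq => (h₁eq _ (by linarith)).le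
  -- From here on `c₁ ≥ H a - mbar > H b`, so `b` is a barrier for `v₁`.
  rcases lt_or_gt_of_ne hpb with hp | hp
  · refine hmin₁ (hasValueAt_of_supersolution hK0 hK hV0 hVm h₁ge hv₁ hc₁ fun R hR => ?_)
    filter_upwards [hc₁.antitoneOn_of_lt hv₁ hV0 (by rw [hb₁]; linarith) hp hR,
      self_mem_nhdsWithin] with lam hm (hlam : 0 < lam)
    exact ((hv₁ lam hlam).supersolutionOn _).transfer_of_antitoneOn
      (hm.mono Ioo_subset_Icc_self) isOpen_Ioo fun q hq => (h₁eq _ (by linarith)).le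
  -- If `c₂` exceeds `H b`, then `b` bounds the slopes of `v₂` from below, where `H₂ = H`.
  rcases lt_or_ge (H b) c₂ with hc | hc
  · refine hmin₂ (hasValueAt_of_supersolution hK0 hK hV0 hVm h₂ge hv₂ hc₂ fun R hR => ?_)
    filter_upwards [hc₂.monotoneOn_of_lt hv₂ hV0 (by rwa [hb₂]) hp hR,
      self_mem_nhdsWithin] with lam hm (hlam : 0 < lam)
    exact ((hv₂ lam hlam).supersolutionOn _).transfer_of_monotoneOn
      (hm.mono Ioo_subset_Icc_self) isOpen_Ioo fun q hq => (h₂eq _ (by linarith)).le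
  have hc' : c₂ + mbar < H₂ a := by rw [ha₂]; linarith
  rcases lt_or_gt_of_ne hpa with hp' | hp'
  -- Here the slopes of `v₂` stay below `a`, where `H₃ = H₂`. Thus `v₂` is a subsolution for `H₃`,
  -- giving `c₃ ≤ c₂ ≤ H b < c₁ ≤ c₃`.
  · exfalso
    obtain ⟨v₃, hv₃, hc₃⟩ := h₃
    have h₃₂ : c₃ ≤ c₂ := by
      refine RescaledLimit.le hK₃0 (lipschitz_shift hK₃ p) V.continuous
        (fun lam hlam => (hv₂ lam hlam).continuous) (fun lam hlam => (hv₃ lam hlam).continuous)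
        (fun R hR => ?_) (fun R _ => ?_) hc₂ hc₃
      · filter_upwards [hc₂.antitoneOn_of_gt hv₂ hVm hc' hp' hR, self_mem_nhdsWithin]
          with lam hm (hlam : 0 < lam)
        refine ((hv₂ lam hlam).subsolutionOn _).transfer_of_antitoneOn
          (hm.mono Ioo_subset_Icc_self) isOpen_Ioo fun q hq => ?_
        rw [h₃eq, h₁eq _ (by linarith)]
        exact max_le (h₂ge _) le_rfl
      · filter_upwards [self_mem_nhdsWithin] with lam (hlam : 0 < lam)
        exact (hv₃ lam hlam).supersolutionOn _
    linarith
  · refine hmin₂ (hasValueAt_of_supersolution hK0 hK hV0 hVm h₂ge hv₂ hc₂ fun R hR => ?_)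
    filter_upwards [hc₂.monotoneOn_of_gt hv₂ hVm hc' hp' hR,
      self_mem_nhdsWithin] with lam hm (hlam : 0 < lam)
    exact ((hv₂ lam hlam).supersolutionOn _).transfer_of_monotoneOn
      (hm.mono Ioo_subset_Icc_self) isOpen_Ioo fun q hq => (h₂eq _ (by linarith)).le

/-! ### The random potential -/

/-- Integer radii suffice, so one null set serves all `R`; uniqueness identifies the solution
families obtained for different radii. -/
theorem HasEffectiveValue.ae_hasValueAt {P : Measure BUC} {H : ℝ → ℝ} {p c : ℝ}
    (h : HasEffectiveValue P H p c) : ∀ᵐ V ∂P, HasValueAt H V p c := by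
  have h1 : ∀ᵐ V ∂P, ∀ N : ℕ, ∃ v : ℝ → ℝ → ℝ,
      (∀ lam : ℝ, 0 < lam → IsCellSolution H V p lam (v lam) ∧
        ∀ w : ℝ → ℝ, IsCellSolution H V p lam w → w = v lam) ∧
      ∀ ε : ℝ, 0 < ε → ∀ᶠ lam in 𝓝[>] (0 : ℝ),
        ∀ y : ℝ, |y| ≤ ((N : ℝ) + 1) / lam → |lam * v lam y + c| ≤ ε :=
    ae_all_iff.2 fun N => h (N + 1) (by positivity)
  filter_upwards [h1] with V hV
  obtain ⟨v, hv, _⟩ := hV 0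
  refine ⟨v, fun lam hlam => (hv lam hlam).1, fun R _ ε hε => ?_⟩
  obtain ⟨N, hN⟩ := exists_nat_ge R
  obtain ⟨w, hw, hwl⟩ := hV N
  filter_upwards [hwl ε hε, self_mem_nhdsWithin] with lam hl (hlam : 0 < lam) y hy
  rw [(hw lam hlam).2 _ (hv lam hlam).1]
  refine hl y ((abs_le.2 hy).trans (div_le_div_of_nonneg_right ?_ hlam.le))
  linarith

theorem hasEffectiveValue_of_ae_hasValueAt {P : Measure BUC} {H : ℝ → ℝ} {K p c : ℝ} (hK0 : 0 ≤ K)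
    (hK : ∀ a b, |H a - H b| ≤ K * |a - b|) (h : ∀ᵐ V ∂P, HasValueAt H V p c) :
    HasEffectiveValue P H p c := by
  intro R hR
  filter_upwards [h] with V hV
  obtain ⟨v, hv, hvl⟩ := hV
  refine ⟨v, fun lam hlam => ⟨hv lam hlam, fun w hw => hw.unique hK0 hK hlam (hv lam hlam)⟩,
    fun ε hε => ?_⟩
  filter_upwards [hvl R hR ε hε] with lam hl y hy
  exact hl y (abs_le.1 hy)

/-- An almost everywhere bound holds on a dense set, hence everywhere by continuity. -/
theorem Continuous.le_of_essSup_eq {f : ℝ → ℝ} (hf : Continuous f) {C m : ℝ}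
    (hC : ∀ x, |f x| ≤ C) (h : essSup f volume = m) (x : ℝ) : f x ≤ m := by
  have hb : IsBoundedUnder (· ≤ ·) (ae volume) f :=
    isBoundedUnder_of ⟨C, fun x => (abs_le.1 (hC x)).2⟩
  have h1 : ∀ᵐ x ∂(volume : Measure ℝ), f x ≤ m := h ▸ ae_le_essSup hb
  have h2 : Dense {x | f x ≤ m} := Measure.dense_of_ae h1
  have h3 : IsClosed {x | f x ≤ m} := isClosed_le hf continuous_const
  have h4 : x ∈ {x | f x ≤ m} := by rw [← h3.closure_eq, h2.closure_eq]; exact mem_univ x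
  exact h4

theorem IsPotentialLaw.ae_bounds {P : Measure BUC} {mbar : ℝ} (h : IsPotentialLaw P mbar) :
    ∀ᵐ V ∂P, (∀ x, V x ≤ 0) ∧ ∀ x, -mbar ≤ V x := by
  filter_upwards [h.esssup_eq, h.esssup_neg_eq] with V h1 h2
  obtain ⟨C, hC⟩ := V.2.2
  refine ⟨V.continuous.le_of_essSup_eq hC h1, fun x => ?_⟩
  have := V.continuous.fun_neg.le_of_essSup_eq (fun x => by rw [abs_neg]; exact hC x) h2 x
  linarith

theorem LipschitzWith.abs_sub_le {K : NNReal} {H : ℝ → ℝ} (h : LipschitzWith K H) (x y : ℝ) :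
    |H x - H y| ≤ K * |x - y| := by
  simpa [Real.dist_eq] using h.dist_le_mul x y

theorem abs_min_sub_min_le {a b c d ε : ℝ} (h₁ : |a - c| ≤ ε) (h₂ : |b - d| ≤ ε) :
    |min a b - min c d| ≤ ε :=
  (abs_min_sub_min_le_max a b c d).trans (max_le h₁ h₂)

/-- The minimum formula under the conditions on the Hamiltonians that its proof needs. -/
theorem hasEffectiveValue_min {P : Measure BUC} [IsProbabilityMeasure P] {mbar : ℝ}
    (hP : IsPotentialLaw P mbar) {H H₁ H₂ H₃ : ℝ → ℝ} {K K₁ K₂ K₃ : NNReal} {a b : ℝ}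
    (hK : LipschitzWith K H) (hK₁ : LipschitzWith K₁ H₁) (hK₂ : LipschitzWith K₂ H₂)
    (hK₃ : LipschitzWith K₃ H₃) (hba : b < a) (hosc : mbar < H a - H b)
    (h₁ge : ∀ q, H q ≤ H₁ q) (h₁eq : ∀ q, q ≤ a → H₁ q = H q) (h₁a : ∀ q, a ≤ q → H a ≤ H₁ q)
    (h₂ge : ∀ q, H q ≤ H₂ q) (h₂eq : ∀ q, b ≤ q → H₂ q = H q)
    (h₃eq : ∀ q, H₃ q = max (H₁ q) (H₂ q)) {c₁ c₂ c₃ : ℝ → ℝ}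
    (h₁ : ∀ p, HasEffectiveValue P H₁ p (c₁ p)) (h₂ : ∀ p, HasEffectiveValue P H₂ p (c₂ p))
    (h₃ : ∀ p, HasEffectiveValue P H₃ p (c₃ p)) (p : ℝ) :
    HasEffectiveValue P H p (min (c₁ p) (c₂ p)) := by
  refine hasEffectiveValue_of_ae_hasValueAt K.2 hK.abs_sub_le ?_
  -- A sequence tending to `p` that eventually avoids both thresholds; being countable, it costs
  -- only one null set.
  set q : ℕ → ℝ := fun n => p + 1 / ((n : ℝ) + 1) with hq
  have hqt : Tendsto q atTop (𝓝 p) := by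
    simpa [hq] using tendsto_one_div_add_atTop_nhds_zero_nat.const_add p
  have hne : ∀ x, ∀ᶠ n in atTop, q n ≠ x := by
    intro x
    by_cases hx : x = p
    · refine Eventually.of_forall fun n => ?_
      have : (0 : ℝ) < 1 / ((n : ℝ) + 1) := by positivity
      rw [hx]
      exact (lt_add_of_pos_right p this).ne'
    · exact hqt.eventually_ne (Ne.symm hx)
  have k₁ := ae_all_iff.2 fun n => (h₁ (q n)).ae_hasValueAt
  have k₂ := ae_all_iff.2 fun n => (h₂ (q n)).ae_hasValueAt
  have k₃ := ae_all_iff.2 fun n => (h₃ (q n)).ae_hasValueAt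
  filter_upwards [hP.ae_bounds, k₁, k₂, k₃, (h₁ p).ae_hasValueAt, (h₂ p).ae_hasValueAt]
    with V hV e₁ e₂ e₃ f₁ f₂
  refine hasValueAt_of_forall_approx K.2 hK.abs_sub_le fun ε hε => ?_
  have hd : Tendsto (fun n => |p - q n|) atTop (𝓝 0) := by
    simpa using (hqt.const_sub p).abs
  have hd₁ : Tendsto (fun n => K₁ * |p - q n|) atTop (𝓝 0) := by
    simpa using hd.const_mul (K₁ : ℝ)
  have hd₂ : Tendsto (fun n => K₂ * |p - q n|) atTop (𝓝 0) := by
    simpa using hd.const_mul (K₂ : ℝ)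
  obtain ⟨n, ⟨⟨⟨hna, hnb⟩, g0⟩, g1⟩, g2⟩ := (((((hne a).and (hne b)).and
    (hd.eventually (gt_mem_nhds hε))).and (hd₁.eventually (gt_mem_nhds hε))).and
    (hd₂.eventually (gt_mem_nhds hε))).exists
  refine ⟨q n, min (c₁ (q n)) (c₂ (q n)), ?_, g0.le, ?_⟩
  · exact hasValueAt_min K.2 hK.abs_sub_le K₁.2 hK₁.abs_sub_le K₃.2 hK₃.abs_sub_le hV.1 hV.2 hba
      hosc h₁ge h₁eq h₁a h₂ge h₂eq h₃eq hna hnb (e₁ n) (e₂ n) (e₃ n)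
  · exact abs_min_sub_min_le ((f₁.abs_sub_le K₁.2 hK₁.abs_sub_le (e₁ n)).trans g1.le)
      ((f₂.abs_sub_le K₂.2 hK₂.abs_sub_le (e₂ n)).trans g2.le)

/-! ### The oscillating Hamiltonian -/

theorem IsOscillatingHamiltonian.pt_lt_of_lt {H : ℝ → ℝ} {L : ℕ} {pt : ℕ → ℝ}
    (hH : IsOscillatingHamiltonian H L pt) {i j : ℕ} (hi : 1 ≤ i) (hij : i < j)
    (hj : j ≤ 2 * L + 1) : pt j < pt i := by
  induction j, hij using Nat.le_induction with
  | base => exact hH.pt_lt i hi (by omega)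
  | succ n hn ih => exact (hH.pt_lt n (by omega) (by omega)).trans (ih (by omega))

/-- A right flattening stays above its value at the threshold. -/
theorem IsRightFlattening.ge_of_le {H H₁ : ℝ → ℝ} {a : ℝ} (h : IsRightFlattening H a H₁) {q : ℝ}
    (hq : a ≤ q) : H a ≤ H₁ q := by
  rcases hq.eq_or_lt with rfl | hlt
  · exact h.ge a
  obtain ⟨K, hK⟩ := h.lipschitz
  rw [← h.eqOn (mem_Iic.2 le_rfl)]
  -- Strict monotonicity is given only on the open ray, so the value at `a` is reached as a limit
  -- from the right.
  refine le_of_tendsto ((hK.continuous.tendsto a).mono_left (nhdsWithin_le_nhds (s := Ioi a))) ?_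
  filter_upwards [Ioo_mem_nhdsGT hlt] with x hx
  exact (h.incr hx.1 hlt hx.2).le

theorem mainTheorem7
    (P : Measure BUC) [IsProbabilityMeasure P] (mbar : ℝ) (hP : IsPotentialLaw P mbar)
    (H : ℝ → ℝ) (L : ℕ) (pt : ℕ → ℝ) (hH : IsOscillatingHamiltonian H L pt)
    -- the oscillation of the potential is not large: `mbar < max_{i,j} (M_i - m_j)`
    (hosc : ∃ i ∈ Icc 1 L, ∃ j ∈ Icc 1 L, mbar < H (pt (2 * i)) - H (pt (2 * j - 1)))
    -- `M_k = max_i M_i`, `m_l = min_i m_i`, and the left side is steeper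
    (k l : ℕ) (hk : k ∈ Icc 1 L) (hl : l ∈ Icc 1 L)
    (hMk : ∀ i ∈ Icc 1 L, H (pt (2 * i)) ≤ H (pt (2 * k)))
    (hml : ∀ i ∈ Icc 1 L, H (pt (2 * l - 1)) ≤ H (pt (2 * i - 1)))
    (hkl : k < l)
    (H₁ H₂ H₃ : ℝ → ℝ)
    (hH₁ : IsRightFlattening H (pt (2 * k)) H₁)
    (hH₂ : IsLeftFlattening H (H (pt (2 * l - 1))) (pt (2 * l)) H₂)
    (hH₃ : ∀ q, H₃ q = max (H₁ q) (H₂ q))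
    (h₁ : RegularlyHomogenizable P H₁) (h₂ : RegularlyHomogenizable P H₂)
    (h₃ : RegularlyHomogenizable P H₃) :
    ∃ h : RegularlyHomogenizable P H, ∀ p : ℝ,
      effectiveHamiltonian h p = min (effectiveHamiltonian h₁ p) (effectiveHamiltonian h₂ p) := by
  obtain ⟨K, hK⟩ := hH.lipschitz
  obtain ⟨K₁, hK₁⟩ := hH₁.lipschitz
  obtain ⟨K₂, hK₂⟩ := hH₂.lipschitz
  have hK₃ : LipschitzWith (max K₁ K₂) H₃ := by
    rw [show H₃ = fun q => max (H₁ q) (H₂ q) from funext hH₃]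
    exact hK₁.max hK₂
  obtain ⟨hk1, hkL⟩ := mem_Icc.1 hk
  obtain ⟨hl1, hlL⟩ := mem_Icc.1 hl
  -- The lower threshold is the minimum `pt (2 * l - 1)`, not `pt (2 * l)` where `H₂` departs from
  -- `H`; `k < l` gives `2 * k < 2 * l - 1`.
  have hba : pt (2 * l - 1) < pt (2 * k) := hH.pt_lt_of_lt (by omega) (by omega) (by omega)
  have hbb : pt (2 * l) < pt (2 * l - 1) := hH.pt_lt_of_lt (by omega) (by omega) (by omega)
  obtain ⟨i, hi, j, hj, hij⟩ := hosc
  have key := hasEffectiveValue_min hP hK hK₁ hK₂ hK₃ hba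
    (by linarith [hMk i hi, hml j hj]) hH₁.ge (fun q hq => hH₁.eqOn hq)
    (fun q hq => hH₁.ge_of_le hq) hH₂.ge (fun q hq => hH₂.eqOn (hbb.le.trans hq)) hH₃
    (effectiveHamiltonian_spec h₁) (effectiveHamiltonian_spec h₂) (effectiveHamiltonian_spec h₃)
  exact ⟨fun p => ⟨⟨mbar, hP⟩, hK.continuous, hH.coercive, _, key p⟩,
    fun p => HasEffectiveValue.unique (effectiveHamiltonian_spec _ p) (key p)⟩
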